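/- **Setting.** For a full-rank state $\sigma$ on $\mathbb{C}^d$ (a positive definite matrix with $\operatorname{tr}\sigma=1$) write $\Gamma_\sigma^{t}(f)=\sigma^{t/2}f\sigma^{t/2}$, $\Gamma_\sigma=\Gamma_\sigma^1$, $\langle f,g\rangle_\sigma=\operatorname{tr}(\Gamma_\sigma(f)g)$, $\|f\|_{2,\sigma}^2=\operatorname{tr}\big(\Gamma_\sigma^{1/2}(f)^2\big)$ and $\operatorname{Var}_\sigma(g)=\operatorname{tr}(\Gamma_\sigma(g)g)-(\operatorname{tr}\Gamma_\sigma(g))^2$ for Hermitian $f,g$. For positive definite $f$ set $$\operatorname{Ent}_1(f)=\operatorname{tr}\big[\Gamma_\sigma(f)\big(\log\Gamma_\sigma(f)-\log\sigma\big)\big]-\operatorname{tr}[\Gamma_\sigma(f)]\log\operatorname{tr}[\Gamma_\sigma(f)],$$ $$\operatorname{Ent}_2(f)=\operatorname{tr}\big[\Gamma_\sigma^{1/2}(f)^2\log\Gamma_\sigma^{1/2}(f)\big]-\tfrac12\operatorname{tr}\big[\Gamma_\sigma^{1/2}(f)^2\log\sigma\big]-\tfrac12\|f\|_{2,\sigma}^2\log\|f\|_{2,\sigma}^2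 .$$ Let $\mathcal L$ be a Liouvillian (a generator of a quantum dynamical semigroup, acting on observables) whose only stationary state is $\sigma$, that is, $\sigma$ is the only state $\rho$ with $\operatorname{tr}(\rho\,\mathcal L(f))=0$ for all matrices $f$. Put $$\mathcal E_1(f)=-\tfrac12\operatorname{tr}\big[\Gamma_\sigma(\mathcal L(f))\big(\log\Gamma_\sigma(f)-\log\sigma\big)\big],\qquad \mathcal E_2(f)=-\langle f,\mathcal L(f)\rangle_\sigma$$ for positive definite, respectively Hermitian, $f$. For $p\in\{1,2\}$ the log-Sobolev constant $\alpha_p(\mathcal L)$ is the largest $\alpha>0$ such that $\alpha\operatorname{Ent}_p(f)\le\mathcal E_p(f)$ for all positive definite $f$. The spectral gap is $\lambda(\mathcal L)=\min\{\mathcal E_2(g)/\operatorname{Var}_\sigma(g) : g \text{ Hermitian},\ \operatorname{Var}_\sigma(g)\neq0\}$. **Statement.** Let $\gamma>0$ and let $\mathcal L(f)=\gamma\big(\operatorname{tr}(f)\,\mathbb 1/2-f\big)$ be the qubit depolarizing Liouvillian on $2\times2$ complex matrices. For $N\ge1$ let $$\mathcal L^{(N)}=\sum_{k=1}^{N}\mathrm{id}^{\otimes(k-1)}\otimes\mathcal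 L\otimes\mathrm{id}^{\otimes(N-k)}$$ be its tensor sum on $N$ qubits. Then $\mathbb 1/2$ is the unique stationary state of $\mathcal L$, $\mathbb 1/2^N$ is the unique stationary state of $\mathcal L^{(N)}$, the constants $\alpha_2(\mathcal L^{(N)})$, $\alpha_2(\mathcal L)$, $\alpha_1(\mathcal L)$ and $\lambda(\mathcal L)$ (taken with respect to these states) exist, and for every $N\ge1$ $$\alpha_2(\mathcal L^{(N)})=\alpha_2(\mathcal L)=\alpha_1(\mathcal L)=\lambda(\mathcal L)=\gamma .$$ -/

import Mathlib

noncomputable section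

/-! Observables on a `d`-dimensional Hilbert space are complex matrices indexed by a finite type
`n` with `d` elements. Real functions of a Hermitian matrix (powers, logarithm, absolute value) are
taken through the continuous functional calculus `cfc`; the spectrum is finite, so every real
function is admissible. Every trace below is real for Hermitian arguments and generators that
preserve Hermiticity, and is read as a real number by taking the real part. -/

section NoncommutativeLp

open scoped ComplexOrder

variable {n : Type*} [Fintype n] [DecidableEq n]

/-- The real power `σ ^ r` of a positive definite matrix. -/
def matPow (σ : Matrix n n ℂ) (r : ℝ) : Matrix n n ℂ :=
  cfc (fun x : ℝ => x ^ r) σ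

/-- The logarithm of a positive definite matrix. -/
def matLog (σ : Matrix n n ℂ) : Matrix n n ℂ :=
  cfc Real.log σ

/-- The weighting `Γ_σ^t (f) = σ^(t/2) f σ^(t/2)`. -/
def Gam (σ : Matrix n n ℂ) (t : ℝ) (f : Matrix n n ℂ) : Matrix n n ℂ :=
  matPow σ (t / 2) * f * matPow σ (t / 2)

/-- The weighted norm `‖f‖_{p,σ} = (tr |Γ_σ^(1/p) (f)|^p)^(1/p)` of a Hermitian `f`. -/
def weightedNorm (σ : Matrix n n ℂ) (p : ℝ) (f : Matrix n n ℂ) : ℝ :=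
  (Matrix.trace (cfc (fun x : ℝ => |x| ^ p) (Gam σ (1 / p) f))).re ^ (1 / p)

/-- The weighted inner product `⟨f, g⟩_σ = tr (Γ_σ(f) g)` of Hermitian matrices. -/
def weightedInner (σ f g : Matrix n n ℂ) : ℝ :=
  (Matrix.trace (Gam σ 1 f * g)).re

/-- `Var_σ(g) = tr (Γ_σ(g) g) - (tr Γ_σ(g))^2`. -/
def weightedVar (σ g : Matrix n n ℂ) : ℝ :=
  weightedInner σ g g - (Matrix.trace (Gam σ 1 g)).re ^ 2

/-- The `L_1` relative entropy of a positive definite `f`. -/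
def entOne (σ f : Matrix n n ℂ) : ℝ :=
  (Matrix.trace (Gam σ 1 f * (matLog (Gam σ 1 f) - matLog σ))).re
    - (Matrix.trace (Gam σ 1 f)).re * Real.log (Matrix.trace (Gam σ 1 f)).re

/-- The `L_2` relative entropy of a positive definite `f`. -/
def entTwo (σ f : Matrix n n ℂ) : ℝ :=
  (Matrix.trace (Gam σ (1 / 2) f ^ 2 * matLog (Gam σ (1 / 2) f))).re
    - 1 / 2 * (Matrix.trace (Gam σ (1 / 2) f ^ 2 * matLog σ)).re
    - 1 / 2 * weightedNorm σ 2 f ^ 2 * Real.log (weightedNorm σ 2 f ^ 2)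

/-- The `L_1` Dirichlet form of a generator `L` at a positive definite `f`. -/
def dirichletOne (L : Module.End ℂ (Matrix n n ℂ)) (σ f : Matrix n n ℂ) : ℝ :=
  -(1 / 2) * (Matrix.trace (Gam σ 1 (L f) * (matLog (Gam σ 1 f) - matLog σ))).re

/-- The `L_2` Dirichlet form of a generator `L` at a Hermitian `f`. -/
def dirichletTwo (L : Module.End ℂ (Matrix n n ℂ)) (σ f : Matrix n n ℂ) : ℝ :=
  -weightedInner σ f (L f)

/-- `σ` is a full-rank state and it is the only state `ρ` with `L^*(ρ) = 0`, where `L^*` is the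
Hilbert-Schmidt dual of `L`: the equation `L^*(ρ) = 0` says that `tr (ρ L(f)) = 0` for all `f`. -/
def IsUniqueFullRankStationaryState (L : Module.End ℂ (Matrix n n ℂ)) (σ : Matrix n n ℂ) : Prop :=
  σ.PosDef ∧ σ.trace = 1 ∧
    ∀ ρ : Matrix n n ℂ, ρ.PosSemidef → ρ.trace = 1 →
      ((∀ f : Matrix n n ℂ, Matrix.trace (ρ * L f) = 0) ↔ ρ = σ)

/-- `α` is the largest positive constant with `α Ent_1(f) ≤ E_1(f)` for all positive
definite `f`. -/
def IsLogSobolevConstOne (L : Module.End ℂ (Matrix n n ℂ)) (σ : Matrix n n ℂ) (α : ℝ) : Prop :=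
  IsGreatest
    {a : ℝ | 0 < a ∧ ∀ f : Matrix n n ℂ, f.PosDef → a * entOne σ f ≤ dirichletOne L σ f} α

/-- `α` is the largest positive constant with `α Ent_2(f) ≤ E_2(f)` for all positive
definite `f`. -/
def IsLogSobolevConstTwo (L : Module.End ℂ (Matrix n n ℂ)) (σ : Matrix n n ℂ) (α : ℝ) : Prop :=
  IsGreatest
    {a : ℝ | 0 < a ∧ ∀ f : Matrix n n ℂ, f.PosDef → a * entTwo σ f ≤ dirichletTwo L σ f} α

/-- `l` is the minimum of `E_2(g) / Var_σ(g)` over Hermitian `g` with nonzero variance. -/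
def IsSpectralGap (L : Module.End ℂ (Matrix n n ℂ)) (σ : Matrix n n ℂ) (l : ℝ) : Prop :=
  IsLeast
    {r : ℝ | ∃ g : Matrix n n ℂ, g.IsHermitian ∧ weightedVar σ g ≠ 0 ∧
      r = dirichletTwo L σ g / weightedVar σ g} l

/-- The maximally mixed state `𝟙 / d`. -/
def maximallyMixed (n : Type*) [Fintype n] [DecidableEq n] : Matrix n n ℂ :=
  ((Fintype.card n : ℂ)⁻¹) • (1 : Matrix n n ℂ)

end NoncommutativeLp

section Qubits

/-- The qubit depolarizing generator `L(f) = γ (tr(f) 𝟙 / 2 - f)`. -/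
def qubitDepol (γ : ℝ) : Module.End ℂ (Matrix (Fin 2) (Fin 2) ℂ) where
  toFun f := (γ : ℂ) • ((f.trace / 2) • (1 : Matrix (Fin 2) (Fin 2) ℂ) - f)
  map_add' f g := by
    rw [Matrix.trace_add, add_div, add_smul, ← smul_add]
    congr 1
    abel
  map_smul' c f := by
    simp only [Matrix.trace_smul, smul_eq_mul, RingHom.id_apply, mul_div_assoc, mul_smul]
    rw [← smul_sub, smul_comm]

/-- `id ⊗ ⋯ ⊗ L ⊗ ⋯ ⊗ id` with `L` at the tensor factor `k`, on `N` qubits. The `N`-fold tensor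
power of the `2 × 2` matrices is the algebra of matrices indexed by bit strings `Fin N → Fin 2`,
where `(f_1 ⊗ ⋯ ⊗ f_N) x y = ∏ j, f_j (x j) (y j)`. -/
def atSite {N : ℕ} (L : Module.End ℂ (Matrix (Fin 2) (Fin 2) ℂ)) (k : Fin N) :
    Module.End ℂ (Matrix (Fin N → Fin 2) (Fin N → Fin 2) ℂ) where
  toFun f := Matrix.of fun x y =>
    L (Matrix.of fun a b => f (Function.update x k a) (Function.update y k b)) (x k) (y k)
  map_add' f g := by
    ext x y
    simp only [Matrix.of_apply, Matrix.add_apply]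
    rw [← Matrix.add_apply, ← map_add]
    rfl
  map_smul' c f := by
    ext x y
    simp only [Matrix.of_apply, Matrix.smul_apply, RingHom.id_apply]
    rw [← Matrix.smul_apply, ← map_smul]
    rfl

/-- The tensor sum `L ⊗ id ⊗ ⋯ ⊗ id + ⋯ + id ⊗ ⋯ ⊗ id ⊗ L` on `N` qubits. -/
def tensorSum (N : ℕ) (L : Module.End ℂ (Matrix (Fin 2) (Fin 2) ℂ)) :
    Module.End ℂ (Matrix (Fin N → Fin 2) (Fin N → Fin 2) ℂ) :=
  ∑ k : Fin N, atSite L k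

end Qubits

end

open Real Filter Topology
open scoped ComplexOrder

/-! At the maximally mixed state all weights are scalars, so every quantity becomes a sum over
eigenvalues (`specSum`). For one qubit the spectral gap is immediate, because `E_2 = γ Var`
identically; the bounds for `α_2` and `α_1` are two-point inequalities for the eigenvalues
(`two_point_logSobolev'`, `entropy_two_point_le`). All constants are optimal by testing on
eigenvalues `1 ± t` with `t → 0` (`le_of_forall_small`).

The substance is `logSobolev`, the `L_2` inequality on `N` qubits, proved by induction on `N`. Split
`M = D + O` into the parts diagonal and off-diagonal in the first qubit. Conjugation by `σ_z` on
that qubit turns `D + O` into `D - O`, so both have the same spectrum, and `specSum_sq_log_add_le`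
bounds the entropy of `M²` by those of `D²` and `O²` plus `2 tr O²` and a scalar term. Both `D` and
`|O|` are block diagonal, so the induction hypothesis applies to their four blocks; passing to `|O|`
keeps the entropy and does not raise the Dirichlet forms (`siteForm_abs_le`). The two-point
inequality for the Hilbert-Schmidt norms of the diagonal blocks of `M`, together with `2 tr O²`, is
paid for by the form of the first site.

The matrix inequality `specSum_sq_log_add_le` comes from `log det`. In an eigenbasis of `O`, the
second difference of `log det (· + s)` in the direction `O` is at most that of the diagonal entries
alone (`logDet_second_difference_le`, by Schur complements). Since `x² log x` is, up to a quadratic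
correction, a negative superposition of the functions `log (x + s)` with weight `s ds`, comparison
for every `s > 0` passes to `x² log x` with the opposite signs (`sum_sq_mul_log_nonpos`). What
remains is scalar: Gross's inequality at each diagonal entry and concavity (`sum_sq_log_split_le`).
-/

/-! ### Scalar inequalities -/

/-- An antiderivative of `s ↦ s * log (x + s)`. -/
lemma hasDerivAt_primitive_mul_log (x T : ℝ) (hx : 0 ≤ x) (hT : 0 < T) :
    HasDerivAt (fun T : ℝ => 1 / 2 * (T ^ 2 - x ^ 2) * log (x + T) - 1 / 4 * T ^ 2 + 1 / 2 * x * T)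
      (T * log (x + T)) T := by
  have h1 : HasDerivAt (fun T : ℝ => log (x + T)) (1 / (x + T)) T :=
    ((hasDerivAt_id T).const_add x).log (by simp; positivity)
  have h2 : HasDerivAt (fun T : ℝ => T ^ 2) (2 * T) T := by simpa using hasDerivAt_pow 2 T
  have h := ((((h2.sub_const (x ^ 2)).const_mul (1 / 2)).mul h1).sub (h2.const_mul (1 / 4))).add
    ((hasDerivAt_id T).const_mul (1 / 2 * x))
  refine h.congr_deriv ?_
  have : x + T ≠ 0 := by positivity
  field_simp
  ring

/-- Second-order Taylor expansion of the logarithm at `y = -x / T`: the remainder is `O(|y|³)`,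
which stays `O(1 / T)` after multiplication by `T²`. -/
lemma tendsto_sq_mul_log_one_add (x : ℝ) :
    Tendsto (fun T : ℝ => T ^ 2 * log (1 + x / T) - x * T) atTop (𝓝 (-x ^ 2 / 2)) := by
  have hb : ∀ᶠ T : ℝ in atTop, ‖(T ^ 2 * log (1 + x / T) - x * T) - (-x ^ 2 / 2)‖
      ≤ 2 * |x| ^ 3 * T⁻¹ := by
    filter_upwards [eventually_ge_atTop (2 * |x| + 1)] with T hT
    have hT0 : 0 < T := by have := abs_nonneg x; linarith
    have hlt : |(-x / T)| ≤ 1 / 2 := by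
      rw [abs_div, abs_neg, abs_of_pos hT0, div_le_div_iff₀ hT0 (by norm_num)]; linarith
    have h := abs_log_sub_add_sum_range_le (x := -x / T) (by linarith) 2
    simp only [Finset.sum_range_succ, Finset.sum_range_zero] at h
    have e1 : 1 - -x / T = 1 + x / T := by ring
    rw [e1] at h
    have h2 : |(-x / T)| ^ (2 + 1) / (1 - |(-x / T)|) ≤ 2 * (|x| / T) ^ 3 := by
      rw [div_le_iff₀ (by linarith)]
      have : |(-x / T)| = |x| / T := by rw [abs_div, abs_neg, abs_of_pos hT0]
      rw [this] at hlt ⊢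
      have : 0 ≤ (|x| / T) ^ 3 := by positivity
      norm_num
      nlinarith
    have h3 := h.trans h2
    have e2 : (T ^ 2 * log (1 + x / T) - x * T) - (-x ^ 2 / 2)
        = T ^ 2 * ((0 + (-x / T) ^ (0 + 1) / ((0 : ℕ) + 1) + (-x / T) ^ (1 + 1) / ((1 : ℕ) + 1))
          + log (1 + x / T)) := by
      push_cast; field_simp; ring
    rw [e2, norm_eq_abs, abs_mul, abs_of_pos (by positivity)]
    calc _ ≤ T ^ 2 * (2 * (|x| / T) ^ 3) := by gcongr
      _ = _ := by field_simp
  have := squeeze_zero_norm' hb (by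
    simpa only [mul_zero] using (tendsto_inv_atTop_zero (𝕜 := ℝ)).const_mul (2 * |x| ^ 3))
  have h := Tendsto.add_const (-x ^ 2 / 2) this
  rw [zero_add] at h
  exact h.congr fun T => by ring

/-- Follows from `log (x + T) = log T + log (1 + x / T)`. The terms subtracted from the primitive
depend on `x` only through `1`, `x` and `x²`, so they disappear for a signed measure whose moments
of order `0, 1, 2` vanish. -/
lemma tendsto_primitive_mul_log (x : ℝ) :
    Tendsto (fun T : ℝ => 1 / 2 * (T ^ 2 - x ^ 2) * log (x + T) - 1 / 4 * T ^ 2 + 1 / 2 * x * T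
      - (1 / 2 * T ^ 2 * log T - 1 / 4 * T ^ 2 + x * T - 1 / 2 * x ^ 2 * log T)) atTop
      (𝓝 (-x ^ 2 / 4)) := by
  have h1 : Tendsto (fun T : ℝ => log (1 + x / T)) atTop (𝓝 0) := by
    have : Tendsto (fun T : ℝ => 1 + x / T) atTop (𝓝 1) := by
      simpa using (tendsto_const_nhds.div_atTop tendsto_id : Tendsto (fun T => x / T) atTop (𝓝 0)).const_add 1
    simpa using this.log one_ne_zero
  have h2 := ((tendsto_sq_mul_log_one_add x).const_mul (1 / 2)).sub (h1.const_mul (1 / 2 * x ^ 2))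
  have e : 1 / 2 * (-x ^ 2 / 2) - 1 / 2 * x ^ 2 * 0 = -x ^ 2 / 4 := by ring
  rw [e] at h2
  refine h2.congr' ?_
  filter_upwards [eventually_gt_atTop (|x|)] with T hT
  have hT0 : 0 < T := (abs_nonneg x).trans_lt hT
  have hx : 0 < 1 + x / T := by
    have : x + T > 0 := by have := neg_abs_le x; linarith
    have : 1 + x / T = (x + T) / T := by field_simp; ring
    rw [this]; positivity
  have : x + T = T * (1 + x / T) := by field_simp; ring
  rw [this, log_mul hT0.ne' hx.ne']
  ring

/-- A signed finite measure on `[0, ∞)` whose moments of order `0, 1, 2` vanish and whose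
logarithmic potential is nonpositive integrates `x² log x` to a nonpositive number. -/
lemma sum_sq_mul_log_nonpos {J : Type*} [Fintype J] (c x : J → ℝ) (hx : ∀ j, 0 ≤ x j)
    (h0 : ∑ j, c j = 0) (h1 : ∑ j, c j * x j = 0) (h2 : ∑ j, c j * x j ^ 2 = 0)
    (hlog : ∀ s : ℝ, 0 < s → ∑ j, c j * log (x j + s) ≤ 0) :
    ∑ j, c j * (x j ^ 2 * log (x j)) ≤ 0 := by
  set H : ℝ → ℝ := fun T => ∑ j, c j * (1 / 2 * (T ^ 2 - x j ^ 2) * log (x j + T)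
    - 1 / 4 * T ^ 2 + 1 / 2 * x j * T) with hH
  have hcont : Continuous H := by
    refine continuous_finsetSum _ fun j _ => continuous_const.mul ?_
    -- Nodes `x j = 0` are allowed, where the logarithm is singular at `T = 0`; extracting the
    -- factor `x j + T` leaves the continuous function `u log u`.
    have : (fun T : ℝ => 1 / 2 * (T ^ 2 - x j ^ 2) * log (x j + T) - 1 / 4 * T ^ 2
        + 1 / 2 * x j * T) = fun T : ℝ => 1 / 2 * (T - x j) * ((x j + T) * log (x j + T))
          - 1 / 4 * T ^ 2 + 1 / 2 * x j * T := by
      funext T; ring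
    rw [this]
    have := continuous_mul_log.comp (continuous_const.add continuous_id : Continuous fun T => x j + T)
    simp only [Function.comp_def] at this
    fun_prop
  -- `H' (T)` is `T` times the logarithmic potential at `T`, hence nonpositive. As `H` tends to `0`
  -- at infinity, `H 0 ≥ 0`, and `H 0` is `-1/2` times the wanted sum.
  have hanti : AntitoneOn H (Set.Ici 0) := by
    refine antitoneOn_of_hasDerivWithinAt_nonpos (f' := fun T => ∑ j, c j * (T * log (x j + T)))
      (convex_Ici 0) hcont.continuousOn ?_ ?_
    · intro T hT
      rw [interior_Ici] at hT
      exact (HasDerivAt.fun_sum fun j _ =>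
        (hasDerivAt_primitive_mul_log (x j) T (hx j) hT).const_mul (c j)).hasDerivWithinAt
    · intro T hT
      rw [interior_Ici] at hT
      have : ∑ j, c j * (T * log (x j + T)) = T * ∑ j, c j * log (x j + T) := by
        rw [Finset.mul_sum]; exact Finset.sum_congr rfl fun j _ => by ring
      rw [this]
      exact mul_nonpos_of_nonneg_of_nonpos (le_of_lt hT) (hlog T hT)
  have hlim : Tendsto H atTop (𝓝 (∑ j, c j * (-x j ^ 2 / 4))) := by
    refine (tendsto_finsetSum _ fun j _ => (tendsto_primitive_mul_log (x j)).const_mul (c j)).congr ?_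
    intro T
    rw [hH, ← sub_eq_zero, ← Finset.sum_sub_distrib]
    have : ∀ j, c j * (1 / 2 * (T ^ 2 - x j ^ 2) * log (x j + T) - 1 / 4 * T ^ 2 + 1 / 2 * x j * T
      - (1 / 2 * T ^ 2 * log T - 1 / 4 * T ^ 2 + x j * T - 1 / 2 * x j ^ 2 * log T))
      - c j * (1 / 2 * (T ^ 2 - x j ^ 2) * log (x j + T) - 1 / 4 * T ^ 2 + 1 / 2 * x j * T)
      = -(1 / 2 * T ^ 2 * log T - 1 / 4 * T ^ 2) * c j - T * (c j * x j)
        + 1 / 2 * log T * (c j * x j ^ 2) := fun j => by ring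
    simp only [this, Finset.sum_add_distrib, Finset.sum_sub_distrib, ← Finset.mul_sum, h0, h1, h2]
    ring
  have hzero : ∑ j, c j * (-x j ^ 2 / 4) = 0 := by
    have : ∀ j, c j * (-x j ^ 2 / 4) = (-1 / 4) * (c j * x j ^ 2) := fun j => by ring
    simp only [this, ← Finset.mul_sum, h2, mul_zero]
  rw [hzero] at hlim
  have hle : 0 ≤ H 0 := by
    refine le_of_tendsto hlim ?_
    filter_upwards [eventually_ge_atTop 0] with T hT
    exact hanti (Set.mem_Ici.2 le_rfl) (Set.mem_Ici.2 hT) hT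
  have h0' : H 0 = -(1 / 2) * ∑ j, c j * (x j ^ 2 * log (x j)) := by
    rw [hH, Finset.mul_sum]
    refine Finset.sum_congr rfl fun j _ => ?_
    simp only [add_zero]
    ring
  linarith

/-! ### Gross's two-point inequality. -/

lemma two_point_logSobolev_unit {t : ℝ} (h0 : 0 ≤ t) (h1 : t ≤ 1) :
    (1 + t) ^ 2 * log (1 + t) + (1 - t) ^ 2 * log (1 - t)
      ≤ (1 + t ^ 2) * log (1 + t ^ 2) + 2 * t ^ 2 := by
  have d1 : ∀ s ∈ Set.Ioo (0 : ℝ) 1, HasDerivAt (fun s : ℝ => log (1 + s)) (1 / (1 + s)) s :=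
    fun s hs => ((hasDerivAt_id s).const_add 1).log (by have := hs.1; simp; linarith)
  have d2 : ∀ s ∈ Set.Ioo (0 : ℝ) 1, HasDerivAt (fun s : ℝ => log (1 - s)) (-1 / (1 - s)) s :=
    fun s hs => ((hasDerivAt_id s).const_sub 1).log (by have := hs.2; simp; linarith)
  have d3 : ∀ s ∈ Set.Ioo (0 : ℝ) 1,
      HasDerivAt (fun s : ℝ => log (1 + s ^ 2)) ((2 * s) / (1 + s ^ 2)) s := fun s hs => by
    have : HasDerivAt (fun s : ℝ => s ^ 2) (2 * s) s := by simpa using hasDerivAt_pow 2 s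
    exact (this.const_add 1).log (by positivity)
  -- half the derivative of the difference of the two sides is itself monotone
  have hk : MonotoneOn (fun s : ℝ => s * log (1 + s ^ 2) + 2 * s - (1 + s) * log (1 + s)
      + (1 - s) * log (1 - s)) (Set.Icc 0 1) := by
    refine monotoneOn_of_hasDerivWithinAt_nonneg (f' := fun s => log (1 + s ^ 2)
      + 2 * s ^ 2 / (1 + s ^ 2) - log (1 + s) - log (1 - s)) (convex_Icc 0 1) ?_ ?_ ?_
    · have a1 : Continuous fun s : ℝ => (1 + s) * log (1 + s) :=
        continuous_mul_log.comp (continuous_const.add continuous_id)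
      have a2 : Continuous fun s : ℝ => (1 - s) * log (1 - s) :=
        continuous_mul_log.comp (continuous_const.sub continuous_id)
      have a3 : Continuous fun s : ℝ => log (1 + s ^ 2) :=
        Continuous.log (by fun_prop) fun s => by positivity
      exact Continuous.continuousOn (by fun_prop)
    · intro s hs
      rw [interior_Icc] at hs
      have p1 : (1 + s) ≠ 0 := by have := hs.1; linarith
      have p2 : (1 - s) ≠ 0 := by have := hs.2; linarith
      have h := ((((hasDerivAt_id s).mul (d3 s hs)).add ((hasDerivAt_id s).const_mul 2)).sub
        (((hasDerivAt_id s).const_add 1).mul (d1 s hs))).add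
        (((hasDerivAt_id s).const_sub 1).mul (d2 s hs))
      refine (h.congr_deriv ?_).hasDerivWithinAt
      simp only [id]
      field_simp
      ring
    · intro s hs
      rw [interior_Icc] at hs
      have p1 : 0 < 1 + s := by have := hs.1; linarith
      have p2 : 0 < 1 - s := by have := hs.2; linarith
      have e1 : 0 ≤ log (1 + s ^ 2) := log_nonneg (by nlinarith)
      have e2 : log (1 + s) + log (1 - s) ≤ 0 := by
        rw [← log_mul p1.ne' p2.ne']
        exact log_nonpos (by positivity) (by nlinarith)
      have e3 : 0 ≤ 2 * s ^ 2 / (1 + s ^ 2) := by positivity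
      linarith
  -- The right side minus the left side, which vanishes at `0`. The squares are split so that only
  -- `u log u` occurs, which is continuous up to the endpoint `s = 1`.
  have hm : MonotoneOn (fun s : ℝ => (1 + s ^ 2) * log (1 + s ^ 2) + 2 * s ^ 2
      - (1 + s) * ((1 + s) * log (1 + s)) - (1 - s) * ((1 - s) * log (1 - s))) (Set.Icc 0 1) := by
    refine monotoneOn_of_hasDerivWithinAt_nonneg (f' := fun s => 2 * (s * log (1 + s ^ 2) + 2 * s
      - (1 + s) * log (1 + s) + (1 - s) * log (1 - s))) (convex_Icc 0 1) ?_ ?_ ?_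
    · have a1 : Continuous fun s : ℝ => (1 + s) * log (1 + s) :=
        continuous_mul_log.comp (continuous_const.add continuous_id)
      have a2 : Continuous fun s : ℝ => (1 - s) * log (1 - s) :=
        continuous_mul_log.comp (continuous_const.sub continuous_id)
      have a3 : Continuous fun s : ℝ => log (1 + s ^ 2) :=
        Continuous.log (by fun_prop) fun s => by positivity
      exact Continuous.continuousOn (by fun_prop)
    · intro s hs
      rw [interior_Icc] at hs
      have p1 : (1 + s) ≠ 0 := by have := hs.1; linarith
      have p2 : (1 - s) ≠ 0 := by have := hs.2; linarith
      have hs2 : HasDerivAt (fun s : ℝ => s ^ 2) (2 * s) s := by simpa using hasDerivAt_pow 2 s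
      have b1 := ((hasDerivAt_id s).const_add 1)
      have b2 := ((hasDerivAt_id s).const_sub 1)
      have h := ((((hs2.const_add 1).mul (d3 s hs)).add (hs2.const_mul 2)).sub
        (b1.mul (b1.mul (d1 s hs)))).sub (b2.mul (b2.mul (d2 s hs)))
      refine (h.congr_deriv ?_).hasDerivWithinAt
      simp only [id, Pi.mul_apply]
      field_simp
      ring
    · intro s hs
      rw [interior_Icc] at hs
      have := hk (Set.left_mem_Icc.2 zero_le_one) (Set.Ioo_subset_Icc_self hs) hs.1.le
      simp only [add_zero, sub_zero, log_one] at this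
      norm_num at this
      linarith
  have := hm (Set.left_mem_Icc.2 zero_le_one) (Set.mem_Icc.2 ⟨h0, h1⟩) h0
  norm_num at this
  nlinarith

/-- Gross's two-point logarithmic Sobolev inequality. -/
lemma two_point_logSobolev {d o : ℝ} (h : |o| ≤ d) :
    (d + o) ^ 2 * log (d + o) + (d - o) ^ 2 * log (d - o)
      ≤ (d ^ 2 + o ^ 2) * log (d ^ 2 + o ^ 2) + 2 * o ^ 2 := by
  wlog ho : 0 ≤ o generalizing o
  · have := this (o := -o) (by rwa [abs_neg]) (by linarith)
    rw [← sub_eq_add_neg, sub_neg_eq_add, neg_sq] at this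
    linarith
  rw [abs_of_nonneg ho] at h
  rcases (ho.trans h).eq_or_lt with rfl | hd
  · obtain rfl : o = 0 := le_antisymm h ho
    simp
  have ht0 : 0 ≤ o / d := by positivity
  have ht1 : o / d ≤ 1 := (div_le_one hd).2 h
  have key := two_point_logSobolev_unit ht0 ht1
  obtain ⟨t, rfl⟩ : ∃ t, o = d * t := ⟨o / d, by field_simp⟩
  rw [mul_div_cancel_left₀ _ hd.ne'] at ht0 ht1 key
  have e1 : (d + d * t) ^ 2 * log (d + d * t)
      = d ^ 2 * ((1 + t) ^ 2 * log (1 + t)) + d ^ 2 * (1 + t) ^ 2 * log d := by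
    rw [show d + d * t = d * (1 + t) by ring, log_mul hd.ne' (by linarith)]; ring
  have e2 : (d - d * t) ^ 2 * log (d - d * t)
      = d ^ 2 * ((1 - t) ^ 2 * log (1 - t)) + d ^ 2 * (1 - t) ^ 2 * log d := by
    rcases eq_or_ne t 1 with h1 | h1
    · simp [h1]
    rw [show d - d * t = d * (1 - t) by ring, log_mul hd.ne' (sub_ne_zero.2 h1.symm)]; ring
  have e3 : (d ^ 2 + (d * t) ^ 2) * log (d ^ 2 + (d * t) ^ 2)
      = d ^ 2 * ((1 + t ^ 2) * log (1 + t ^ 2)) + 2 * d ^ 2 * (1 + t ^ 2) * log d := by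
    rw [show d ^ 2 + (d * t) ^ 2 = d ^ 2 * (1 + t ^ 2) by ring,
      log_mul (by positivity) (by positivity), log_pow]; push_cast; ring
  rw [e1, e2, e3]
  have := mul_le_mul_of_nonneg_left key (sq_nonneg d)
  nlinarith

/-- The two-point inequality in terms of the values at the two points. -/
lemma two_point_logSobolev' {a b : ℝ} (ha : 0 ≤ a) (hb : 0 ≤ b) :
    a ^ 2 * log (a ^ 2) + b ^ 2 * log (b ^ 2)
      ≤ (a ^ 2 + b ^ 2) * log ((a ^ 2 + b ^ 2) / 2) + (a - b) ^ 2 := by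
  have h := two_point_logSobolev (d := (a + b) / 2) (o := (a - b) / 2)
    (by rw [abs_le]; constructor <;> linarith)
  rw [show (a + b) / 2 + (a - b) / 2 = a by ring, show (a + b) / 2 - (a - b) / 2 = b by ring,
    show ((a + b) / 2) ^ 2 + ((a - b) / 2) ^ 2 = (a ^ 2 + b ^ 2) / 2 by ring] at h
  rw [log_pow, log_pow]
  push_cast
  nlinarith

/-! ### Entropy splitting and the scalar inequalities for Schur complements and `L_1`. -/

/-- The tangent-plane bound for `(u, v) ↦ η(u + v) - η u - η v`, where `η x = x log x`. -/
lemma add_mul_log_add_le {u v U V : ℝ} (hu : 0 ≤ u) (hv : 0 ≤ v) (hU : 0 < U) (hV : 0 < V) :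
    (u + v) * log (u + v) - u * log u - v * log v
      ≤ u * log ((U + V) / U) + v * log ((U + V) / V) := by
  have hUV : 0 < U + V := by positivity
  rcases hu.eq_or_lt with rfl | hu
  · have : 0 ≤ log ((U + V) / V) := log_nonneg (by rw [le_div_iff₀ hV]; linarith)
    simp; positivity
  rcases hv.eq_or_lt with rfl | hv
  · have : 0 ≤ log ((U + V) / U) := log_nonneg (by rw [le_div_iff₀ hU]; linarith)
    simp; positivity
  have huv : 0 < u + v := by positivity
  -- `log z ≤ z - 1` with `z` the quotient of `(u + v) / u` by `(U + V) / U`, and likewise for `v`.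
  -- Weighted by `u` and `v`, the two right-hand sides cancel.
  have k1 := mul_le_mul_of_nonneg_left
    (log_le_sub_one_of_pos (x := (u + v) / u * (U / (U + V))) (by positivity)) hu.le
  have k2 := mul_le_mul_of_nonneg_left
    (log_le_sub_one_of_pos (x := (u + v) / v * (V / (U + V))) (by positivity)) hv.le
  rw [log_mul (by positivity) (by positivity), log_div huv.ne' hu.ne', log_div hU.ne' hUV.ne'] at k1
  rw [log_mul (by positivity) (by positivity), log_div huv.ne' hv.ne', log_div hV.ne' hUV.ne'] at k2
  rw [log_div hUV.ne' hU.ne', log_div hUV.ne' hV.ne']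
  have e : u * ((u + v) / u * (U / (U + V)) - 1) + v * ((u + v) / v * (V / (U + V)) - 1) = 0 := by
    field_simp; ring
  nlinarith

/-- The scalar form of the Hessian bound: `d i ± o i` are the values of a function and its
reflection, `U` bounds the second moment of `d` and `V` is the second moment of `o`. -/
lemma sum_sq_log_split_le {ι : Type*} [Fintype ι] (d o : ι → ℝ) (h : ∀ i, |o i| ≤ d i) {U V : ℝ}
    (hU : ∑ i, d i ^ 2 ≤ U) (hV : ∑ i, o i ^ 2 = V) :
    ∑ i, ((d i + o i) ^ 2 * log (d i + o i) + (d i - o i) ^ 2 * log (d i - o i)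
        - 2 * (d i ^ 2 * log (d i)))
      ≤ (U + V) * log (U + V) - U * log U - V * log V
        + 2 * ∑ i, o i ^ 2 * log (o i) + 2 * V := by
  have hpt : ∀ i, (d i + o i) ^ 2 * log (d i + o i) + (d i - o i) ^ 2 * log (d i - o i)
        - 2 * (d i ^ 2 * log (d i)) - 2 * (o i ^ 2 * log (o i))
      ≤ (d i ^ 2 + o i ^ 2) * log (d i ^ 2 + o i ^ 2) - d i ^ 2 * log (d i ^ 2)
        - o i ^ 2 * log (o i ^ 2) + 2 * o i ^ 2 := fun i => by
    have := two_point_logSobolev (h i)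
    rw [log_pow, log_pow]; push_cast; linarith
  have hV0 : 0 ≤ V := hV ▸ Finset.sum_nonneg fun i _ => sq_nonneg _
  rcases hV0.eq_or_lt with h0 | hVpos
  · have ho : ∀ i, o i = 0 := by
      intro i
      have := (Finset.sum_eq_zero_iff_of_nonneg (fun i _ => sq_nonneg (o i))).1 (hV.trans h0.symm) i
        (Finset.mem_univ i)
      exact pow_eq_zero_iff two_ne_zero |>.1 this
    simp only [ho, ← h0]
    refine le_of_eq ?_
    simp only [add_zero, sub_zero]
    simp only [← two_mul, sub_self]
    simp
  have hUpos : 0 < U := by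
    refine lt_of_lt_of_le hVpos (le_trans ?_ hU)
    rw [← hV]
    exact Finset.sum_le_sum fun i _ => sq_le_sq' (abs_le.1 (h i)).1 (abs_le.1 (h i)).2
  have hUV : 0 < U + V := by positivity
  have hs := Finset.sum_le_sum fun i (_ : i ∈ Finset.univ) => (hpt i).trans
    (add_le_add_left (add_mul_log_add_le (sq_nonneg (d i)) (sq_nonneg (o i)) hUpos hVpos)
      (2 * o i ^ 2))
  simp only [Finset.sum_add_distrib, Finset.sum_sub_distrib, ← Finset.mul_sum, ← Finset.sum_mul,
    hV] at hs ⊢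
  -- The second moment of `d` is only bounded by `U`; its coefficient is nonnegative, so it may be
  -- replaced by `U`.
  have hl : 0 ≤ log ((U + V) / U) := log_nonneg (by rw [le_div_iff₀ hUpos]; linarith)
  have := mul_le_mul_of_nonneg_right hU hl
  rw [log_div hUV.ne' hUpos.ne', log_div hUV.ne' hVpos.ne'] at hs
  rw [log_div hUV.ne' hUpos.ne'] at this
  nlinarith

/-- The numerical inequality behind one step of Schur complementation. -/
lemma schur_step_le {p o a b c : ℝ} (ha : 0 ≤ a) (hb : 0 ≤ b) (hc : 0 ≤ c) (hbc : a ^ 2 ≤ b * c)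
    (hpb : b < p + o) (hpc : c < p - o) :
    (p + o - b) * (p - o - c) * p ^ 2 ≤ (p - a) ^ 2 * ((p + o) * (p - o)) := by
  have hp : 0 < p := by linarith
  set g := √((p + o) * (p - o)) with hg
  have hgg : g ^ 2 = (p + o) * (p - o) := sq_sqrt (mul_nonneg (by linarith) (by linarith))
  have hgp : g ≤ p := by
    rw [hg, sqrt_le_left hp.le]; nlinarith [sq_nonneg o]
  set β := √(b * c) with hβ
  have hββ : β ^ 2 = b * c := sq_sqrt (mul_nonneg hb hc)
  have hg0 : 0 ≤ g := sqrt_nonneg _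
  have hβ0 : 0 ≤ β := sqrt_nonneg _
  have hβg : β ≤ g := sqrt_le_sqrt (by nlinarith)
  have haβ : a ≤ β := (le_sqrt ha (mul_nonneg hb hc)).2 hbc
  -- AM-GM on the cross terms, whose product is `(g β)²`. Then `a ≤ β ≤ g` replaces `β` by `a`, and
  -- `g ≤ p` gives `1 - a / g ≤ 1 - a / p`.
  have h1 : (p + o - b) * (p - o - c) ≤ (g - β) ^ 2 := by
    have : 2 * (g * β) ≤ b * (p - o) + c * (p + o) := by
      refine abs_le_of_sq_le_sq' ?_ ?_ |>.2
      · have : (2 * (g * β)) ^ 2 = 4 * ((p + o) * (p - o)) * (b * c) := by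
          rw [← hgg, ← hββ]; ring
        rw [this]
        nlinarith [sq_nonneg (b * (p - o) - c * (p + o))]
      · have := mul_nonneg hb (by linarith : 0 ≤ p - o)
        have := mul_nonneg hc (by linarith : 0 ≤ p + o)
        linarith
    nlinarith
  have h2 : (g - β) ^ 2 ≤ (g - a) ^ 2 := by
    apply pow_le_pow_left₀ <;> linarith
  have h3 : (g - a) * p ≤ (p - a) * g := by nlinarith
  have h4 : ((g - a) * p) ^ 2 ≤ ((p - a) * g) ^ 2 :=
    pow_le_pow_left₀ (mul_nonneg (by linarith) hp.le) h3 2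
  calc _ ≤ (g - a) ^ 2 * p ^ 2 := mul_le_mul_of_nonneg_right (h1.trans h2) (sq_nonneg p)
    _ = ((g - a) * p) ^ 2 := by ring
    _ ≤ _ := h4
    _ = (p - a) ^ 2 * ((p + o) * (p - o)) := by rw [mul_pow, hgg]

/-- The numerical inequality behind the `L₁` logarithmic Sobolev inequality of a qubit. -/
lemma two_add_mul_log_le {t : ℝ} (h0 : 0 ≤ t) (h1 : t < 1) :
    (2 + t) * log (1 + t) + (2 - t) * log (1 - t) ≤ 0 := by
  have d1 : ∀ s ∈ Set.Ico (0 : ℝ) 1, HasDerivAt (fun s : ℝ => log (1 + s)) (1 / (1 + s)) s :=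
    fun s hs => ((hasDerivAt_id s).const_add 1).log (by have := hs.1; simp; linarith)
  have d2 : ∀ s ∈ Set.Ico (0 : ℝ) 1, HasDerivAt (fun s : ℝ => log (1 - s)) (-1 / (1 - s)) s :=
    fun s hs => ((hasDerivAt_id s).const_sub 1).log (by have := hs.2; simp; linarith)
  -- The derivative of the left-hand side. It vanishes at `0`, and its own derivative is `-4 s² / (1
  -- - s²)²`.
  have hk : AntitoneOn (fun s : ℝ => log (1 + s) - log (1 - s) + 1 / (1 + s) - 1 / (1 - s))
      (Set.Ico 0 1) := by
    have hd : ∀ s ∈ Set.Ico (0 : ℝ) 1, HasDerivAt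
        (fun s : ℝ => log (1 + s) - log (1 - s) + 1 / (1 + s) - 1 / (1 - s))
        (1 / (1 + s) + 1 / (1 - s) - 1 / (1 + s) ^ 2 - 1 / (1 - s) ^ 2) s := by
      intro s hs
      have p1 : (1 + s) ≠ 0 := by have := hs.1; linarith
      have p2 : (1 - s) ≠ 0 := by have := hs.2; linarith
      have b1 : HasDerivAt (fun s : ℝ => 1 / (1 + s)) (-1 / (1 + s) ^ 2) s := by
        simpa using ((hasDerivAt_id s).const_add 1).fun_inv p1
      have b2 : HasDerivAt (fun s : ℝ => 1 / (1 - s)) (1 / (1 - s) ^ 2) s := by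
        simpa using ((hasDerivAt_id s).const_sub 1).fun_inv p2
      refine ((((d1 s hs).sub (d2 s hs)).add b1).sub b2).congr_deriv ?_
      ring
    refine antitoneOn_of_hasDerivWithinAt_nonpos (convex_Ico 0 1)
      (fun s hs => (hd s hs).continuousAt.continuousWithinAt)
      (fun s hs => (hd s (interior_subset hs)).hasDerivWithinAt) fun s hs => ?_
    have hs := interior_subset hs
    have p1 : 0 < 1 + s := by have := hs.1; linarith
    have p2 : 0 < 1 - s := by have := hs.2; linarith
    have : 1 / (1 + s) + 1 / (1 - s) - 1 / (1 + s) ^ 2 - 1 / (1 - s) ^ 2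
        = -(4 * s ^ 2 / ((1 + s) ^ 2 * (1 - s) ^ 2)) := by field_simp; ring
    rw [this]
    have : 0 ≤ 4 * s ^ 2 / ((1 + s) ^ 2 * (1 - s) ^ 2) := by positivity
    linarith
  have hm : AntitoneOn (fun s : ℝ => (2 + s) * log (1 + s) + (2 - s) * log (1 - s))
      (Set.Ico 0 1) := by
    have hd : ∀ s ∈ Set.Ico (0 : ℝ) 1, HasDerivAt
        (fun s : ℝ => (2 + s) * log (1 + s) + (2 - s) * log (1 - s))
        (log (1 + s) - log (1 - s) + 1 / (1 + s) - 1 / (1 - s)) s := by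
      intro s hs
      have p1 : (1 + s) ≠ 0 := by have := hs.1; linarith
      have p2 : (1 - s) ≠ 0 := by have := hs.2; linarith
      refine ((((hasDerivAt_id s).const_add 2).mul (d1 s hs)).add
        (((hasDerivAt_id s).const_sub 2).mul (d2 s hs))).congr_deriv ?_
      simp only [id]
      field_simp
      ring
    refine antitoneOn_of_hasDerivWithinAt_nonpos (convex_Ico 0 1)
      (fun s hs => (hd s hs).continuousAt.continuousWithinAt)
      (fun s hs => (hd s (interior_subset hs)).hasDerivWithinAt) fun s hs => ?_
    have hs := interior_subset hs
    simpa using hk (Set.left_mem_Ico.2 one_pos) hs hs.1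
  simpa using hm (Set.left_mem_Ico.2 one_pos) ⟨h0, h1⟩ h0

/-- This bound and the next serve only for optimality of the constants: they bound the entropies of
the test functions from below to order `t²`. -/
lemma sub_sq_div_two_le_log_one_add {t : ℝ} (h0 : 0 ≤ t) : t - t ^ 2 / 2 ≤ log (1 + t) := by
  have hd : ∀ s ∈ Set.Ici (0 : ℝ), HasDerivAt (fun s : ℝ => log (1 + s) - (s - s ^ 2 / 2))
      (1 / (1 + s) - (1 - s)) s := fun s hs => by
    have h1 : HasDerivAt (fun s : ℝ => log (1 + s)) (1 / (1 + s)) s :=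
      ((hasDerivAt_id s).const_add 1).log (by have : 0 ≤ s := hs; simp; linarith)
    have h2 : HasDerivAt (fun s : ℝ => s ^ 2) (2 * s) s := by simpa using hasDerivAt_pow 2 s
    exact (h1.sub ((hasDerivAt_id s).sub (h2.div_const 2))).congr_deriv (by ring)
  have hm : MonotoneOn (fun s : ℝ => log (1 + s) - (s - s ^ 2 / 2)) (Set.Ici 0) := by
    refine monotoneOn_of_hasDerivWithinAt_nonneg (convex_Ici 0)
      (fun s hs => (hd s hs).continuousAt.continuousWithinAt)
      (fun s hs => (hd s (interior_subset hs)).hasDerivWithinAt) fun s hs => ?_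
    have hs : 0 ≤ s := interior_subset hs
    have : 1 / (1 + s) - (1 - s) = s ^ 2 / (1 + s) := by
      have : 1 + s ≠ 0 := by positivity
      field_simp; ring
    rw [this]; positivity
  have := hm (Set.mem_Ici.2 le_rfl) (Set.mem_Ici.2 h0) h0
  simp at this
  linarith

lemma neg_sub_sub_cube_le_log_one_sub {t : ℝ} (h0 : 0 ≤ t) (h1 : t ≤ 1 / 2) :
    -t - t ^ 2 / 2 - t ^ 3 ≤ log (1 - t) := by
  have hd : ∀ s ∈ Set.Icc (0 : ℝ) (1 / 2), HasDerivAt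
      (fun s : ℝ => log (1 - s) - (-s - s ^ 2 / 2 - s ^ 3))
      (-1 / (1 - s) - (-1 - s - 3 * s ^ 2)) s := fun s hs => by
    have h1 : HasDerivAt (fun s : ℝ => log (1 - s)) (-1 / (1 - s)) s :=
      ((hasDerivAt_id s).const_sub 1).log (by have := hs.2; simp; linarith)
    have h2 : HasDerivAt (fun s : ℝ => s ^ 2) (2 * s) s := by simpa using hasDerivAt_pow 2 s
    have h3 : HasDerivAt (fun s : ℝ => s ^ 3) (3 * s ^ 2) s := by simpa using hasDerivAt_pow 3 s
    exact (h1.sub (((hasDerivAt_id s).neg.sub (h2.div_const 2)).sub h3)).congr_deriv (by ring)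
  have hm : MonotoneOn (fun s : ℝ => log (1 - s) - (-s - s ^ 2 / 2 - s ^ 3))
      (Set.Icc 0 (1 / 2)) := by
    refine monotoneOn_of_hasDerivWithinAt_nonneg (convex_Icc _ _)
      (fun s hs => (hd s hs).continuousAt.continuousWithinAt)
      (fun s hs => (hd s (interior_subset hs)).hasDerivWithinAt) fun s hs => ?_
    have hs := interior_subset hs
    have p : 0 < 1 - s := by have := hs.2; linarith
    -- The cubic coefficient `1`, larger than the Taylor coefficient `1/3`, makes this nonnegative
    -- for `s ≤ 2/3`, hence on all of `[0, 1/2]`.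
    have : -1 / (1 - s) - (-1 - s - 3 * s ^ 2) = s ^ 2 * (2 - 3 * s) / (1 - s) := by
      field_simp; ring
    rw [this]
    have : 0 ≤ 2 - 3 * s := by have := hs.2; linarith
    positivity
  have := hm (Set.left_mem_Icc.2 (by norm_num)) ⟨h0, h1⟩ h0
  simp at this
  linarith

/-- The logarithm of the determinant of a positive definite matrix. -/
noncomputable def logDet {n : Type*} [Fintype n] [DecidableEq n] (X : Matrix n n ℂ) : ℝ :=
  log X.det.re

/-! ### Second differences of the logarithm of the determinant -/

namespace Matrix

variable {n : Type*} [Fintype n] [DecidableEq n]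

lemma PosDef.det_re_pos {X : Matrix n n ℂ} (h : X.PosDef) : 0 < X.det.re ∧ X.det.im = 0 := by
  have := h.det_pos
  rw [Complex.lt_def] at this
  exact ⟨this.1, this.2.symm⟩

lemma logDet_submatrix {m : Type*} [Fintype m] [DecidableEq m] (X : Matrix n n ℂ) (e : m ≃ n) :
    logDet (X.submatrix e e) = logDet X := by
  rw [logDet, logDet, det_submatrix_equiv_self]

/-- Splitting off one row and column: the determinant is that of the remaining block times the
Schur complement. -/
lemma PosDef.logDet_option {M : Matrix (Option n) (Option n) ℂ} (h : M.PosDef) :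
    0 < (M none none).re
        - (star (fun i => M (some i) none) ⬝ᵥ
          ((M.submatrix some some)⁻¹ *ᵥ fun i => M (some i) none)).re ∧
      logDet M = logDet (M.submatrix some some)
        + log ((M none none).re - (star (fun i => M (some i) none) ⬝ᵥ
          ((M.submatrix some some)⁻¹ *ᵥ fun i => M (some i) none)).re) := by
  set X := M.submatrix (some : n → Option n) some with hX
  have hXp : X.PosDef := h.submatrix (Option.some_injective n)
  set v : n → ℂ := fun i => M (some i) none with hv
  let e : n ⊕ Unit ≃ Option n := (Equiv.optionEquivSumPUnit n).symm
  have hM : M.submatrix e e = fromBlocks X (replicateCol Unit v) (replicateRow Unit (star v))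
      (of fun _ _ => M none none) := by
    ext i j
    rcases i with i | i <;> rcases j with j | j
    · rfl
    · rfl
    · change M none (some j) = star (M (some j) none)
      rw [h.1.apply]
    · rfl
  have : Invertible X := hXp.isUnit.invertible
  have hdet : M.det = X.det * (M none none - star v ⬝ᵥ (X⁻¹ *ᵥ v)) := by
    rw [← det_submatrix_equiv_self e M, hM, det_fromBlocks₁₁, det_unique (n := Unit), invOf_eq_nonsing_inv]
    congr 1
    simp only [sub_apply, of_apply, Matrix.mul_assoc, mul_apply, replicateRow_apply,
      replicateCol_apply, dotProduct, mulVec]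
  have h1 := h.det_re_pos
  have h2 := hXp.det_re_pos
  have hre : M.det.re = X.det.re * ((M none none).re - (star v ⬝ᵥ (X⁻¹ *ᵥ v)).re) := by
    rw [hdet, Complex.mul_re, h2.2, zero_mul, sub_zero, Complex.sub_re]
  have hpos : 0 < (M none none).re - (star v ⬝ᵥ (X⁻¹ *ᵥ v)).re := by
    have := h1.1
    rw [hre] at this
    exact (mul_pos_iff_of_pos_left h2.1).1 this
  exact ⟨hpos, by rw [logDet, logDet, hre, log_mul h2.1.ne' hpos.ne']⟩

/-- Cauchy-Schwarz for the pair of forms given by `X` and `X⁻¹`, in linearised form. -/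
lemma PosDef.two_mul_re_dotProduct_le {X : Matrix n n ℂ} (h : X.PosDef) (v w : n → ℂ) :
    2 * (star w ⬝ᵥ v).re ≤ (star v ⬝ᵥ (X⁻¹ *ᵥ v)).re + (star w ⬝ᵥ (X *ᵥ w)).re := by
  have hu : IsUnit X.det := (isUnit_iff_isUnit_det X).1 h.isUnit
  -- Expanding the form of `X` at `X⁻¹ v - w` gives exactly the difference of the two sides.
  have h0 := h.posSemidef.re_dotProduct_nonneg (X⁻¹ *ᵥ v - w)
  have e1 : X *ᵥ (X⁻¹ *ᵥ v) = v := by rw [mulVec_mulVec, mul_nonsing_inv X hu, one_mulVec]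
  have e2 : star (X⁻¹ *ᵥ v) ⬝ᵥ (X *ᵥ w) = star v ⬝ᵥ w := by
    rw [star_mulVec, ← dotProduct_mulVec, h.1.inv.eq, mulVec_mulVec, nonsing_inv_mul X hu,
      one_mulVec]
  have e3 : star (X⁻¹ *ᵥ v) ⬝ᵥ v = star v ⬝ᵥ (X⁻¹ *ᵥ v) := by
    rw [star_mulVec, ← dotProduct_mulVec, h.1.inv.eq]
  have e4 : (star v ⬝ᵥ w).re = (star w ⬝ᵥ v).re := by
    rw [← Complex.conj_re, ← Complex.star_def, star_dotProduct, star_star]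
  rw [mulVec_sub, star_sub, sub_dotProduct, dotProduct_sub, dotProduct_sub, e1, e2, e3] at h0
  simp only [RCLike.re_to_complex, Complex.sub_re, e4] at h0
  linarith

lemma PosDef.inv_form_nonneg {X : Matrix n n ℂ} (h : X.PosDef) (v : n → ℂ) :
    0 ≤ (star v ⬝ᵥ (X⁻¹ *ᵥ v)).re := h.inv.posSemidef.re_dotProduct_nonneg v

/-- The quadratic form of the inverse is geometrically midpoint convex. -/
lemma sq_inv_form_le {Q O : Matrix n n ℂ} (hQ : Q.PosDef) (hp : (Q + O).PosDef)
    (hm : (Q - O).PosDef) (v : n → ℂ) :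
    (star v ⬝ᵥ (Q⁻¹ *ᵥ v)).re ^ 2
      ≤ (star v ⬝ᵥ ((Q + O)⁻¹ *ᵥ v)).re * (star v ⬝ᵥ ((Q - O)⁻¹ *ᵥ v)).re := by
  have hu : IsUnit Q.det := (isUnit_iff_isUnit_det Q).1 hQ.isUnit
  set a := (star v ⬝ᵥ (Q⁻¹ *ᵥ v)).re with ha
  set b := (star v ⬝ᵥ ((Q + O)⁻¹ *ᵥ v)).re with hb
  set c := (star v ⬝ᵥ ((Q - O)⁻¹ *ᵥ v)).re with hc
  have a0 : 0 ≤ a := hQ.inv_form_nonneg v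
  have b0 : 0 ≤ b := hp.inv_form_nonneg v
  have c0 : 0 ≤ c := hm.inv_form_nonneg v
  set w := Q⁻¹ *ᵥ v with hw
  have e1 : (star w ⬝ᵥ v).re = a := by
    rw [hw, star_mulVec, ← dotProduct_mulVec, hQ.1.inv.eq]
  have e2 : (star w ⬝ᵥ (Q *ᵥ w)).re = a := by
    rw [← e1, hw, mulVec_mulVec _ Q, mul_nonsing_inv Q hu, one_mulVec]
  set q := (star w ⬝ᵥ (O *ᵥ w)).re with hq
  -- With `w = Q⁻¹ v` as the common test vector and a free scale `l`, the discriminants give `a² ≤ b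
  -- (a + q)` and `a² ≤ c (a - q)`; the product of the two bounds removes `q`.
  have key : ∀ {X : Matrix n n ℂ} (_ : X.PosDef) (l : ℝ),
      2 * (l * a) ≤ (star v ⬝ᵥ (X⁻¹ *ᵥ v)).re + l ^ 2 * (star w ⬝ᵥ (X *ᵥ w)).re := by
    intro X hX l
    have h := hX.two_mul_re_dotProduct_le v ((l : ℂ) • w)
    rw [star_smul, smul_dotProduct, mulVec_smul, smul_dotProduct, dotProduct_smul] at h
    simp only [smul_eq_mul, Complex.star_def, Complex.conj_ofReal, Complex.re_ofReal_mul, e1] at h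
    nlinarith
  have f1 : (star w ⬝ᵥ ((Q + O) *ᵥ w)).re = a + q := by
    rw [add_mulVec, dotProduct_add, Complex.add_re, e2]
  have f2 : (star w ⬝ᵥ ((Q - O) *ᵥ w)).re = a - q := by
    rw [sub_mulVec, dotProduct_sub, Complex.sub_re, e2]
  have kp := fun l => key hp l
  have km := fun l => key hm l
  rw [f1] at kp
  rw [f2] at km
  have p0 : 0 ≤ a + q := f1 ▸ hp.posSemidef.re_dotProduct_nonneg w
  have m0 : 0 ≤ a - q := f2 ▸ hm.posSemidef.re_dotProduct_nonneg w
  rcases a0.eq_or_lt with h | hapos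
  · rw [← h, zero_pow two_ne_zero]; exact mul_nonneg b0 c0
  clear_value a b c q
  have hbq : a ^ 2 ≤ b * (a + q) := by
    have := discrim_le_zero (a := a + q) (b := -(2 * a)) (c := b) fun l => by
      have := kp l; nlinarith
    rw [discrim] at this; nlinarith
  have hcq : a ^ 2 ≤ c * (a - q) := by
    have := discrim_le_zero (a := a - q) (b := -(2 * a)) (c := c) fun l => by
      have := km l; nlinarith
    rw [discrim] at this; nlinarith
  have h4 : a ^ 2 * a ^ 2 ≤ (b * c) * a ^ 2 := by
    calc a ^ 2 * a ^ 2 ≤ (b * (a + q)) * (c * (a - q)) :=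
          mul_le_mul hbq hcq (sq_nonneg a) (mul_nonneg b0 p0)
      _ = (b * c) * (a ^ 2 - q ^ 2) := by ring
      _ ≤ (b * c) * a ^ 2 :=
          mul_le_mul_of_nonneg_left (sub_le_self _ (sq_nonneg q)) (mul_nonneg b0 c0)
  exact le_of_mul_le_mul_right h4 (pow_pos hapos 2)

lemma posDef_of_add_sub {m : Type*} {P O : Matrix m m ℂ} (hp : (P + O).PosDef) (hm : (P - O).PosDef) :
    P.PosDef := by
  have : P = (1 / 2 : ℝ) • ((P + O) + (P - O)) := by
    rw [add_add_sub_cancel, ← two_smul ℝ, smul_smul]; norm_num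
  rw [this]
  exact (hp.add hm).smul (by norm_num)

/-- The second difference of `log det` in a diagonal direction is at most its value after all
off-diagonal entries are discarded. -/
theorem logDet_second_difference_le (m : Type*) [Fintype m] :
    ∀ [DecidableEq m] (P : Matrix m m ℂ) (o : m → ℝ),
      (P + diagonal fun i => (o i : ℂ)).PosDef → (P - diagonal fun i => (o i : ℂ)).PosDef →
      logDet (P + diagonal fun i => (o i : ℂ)) + logDet (P - diagonal fun i => (o i : ℂ))
          - 2 * logDet P
        ≤ ∑ i, (log ((P i i).re + o i) + log ((P i i).re - o i) - 2 * log (P i i).re) := by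
  refine Fintype.induction_empty_option (P := fun m _ => ∀ [DecidableEq m] (P : Matrix m m ℂ)
    (o : m → ℝ), (P + diagonal fun i => (o i : ℂ)).PosDef →
      (P - diagonal fun i => (o i : ℂ)).PosDef →
      logDet (P + diagonal fun i => (o i : ℂ)) + logDet (P - diagonal fun i => (o i : ℂ))
          - 2 * logDet P
        ≤ ∑ i, (log ((P i i).re + o i) + log ((P i i).re - o i) - 2 * log (P i i).re)) ?_ ?_ ?_ m
  · intro α β _ e ih _ P o hp hm
    let _ := Fintype.ofEquiv β e.symm
    classical
    have hs : ∀ X : Matrix β β ℂ, X.PosDef → (X.submatrix e e).PosDef :=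
      fun X hX => hX.submatrix e.injective
    have hd : (diagonal fun i => (o i : ℂ)).submatrix e e = diagonal fun i => (o (e i) : ℂ) := by
      rw [submatrix_diagonal_equiv]; rfl
    have h := ih (P.submatrix e e) (fun i => o (e i))
      (by rw [← hd]; exact hs _ hp) (by rw [← hd]; exact hs _ hm)
    rw [← hd] at h
    have e1 := logDet_submatrix (P + diagonal fun i => (o i : ℂ)) e
    have e2 := logDet_submatrix (P - diagonal fun i => (o i : ℂ)) e
    rw [submatrix_add, Pi.add_apply, Pi.add_apply] at e1
    rw [submatrix_sub, Pi.sub_apply, Pi.sub_apply] at e2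
    rw [e1, e2, logDet_submatrix] at h
    refine h.trans_eq ?_
    exact e.sum_comp fun i => (log ((P i i).re + o i) + log ((P i i).re - o i) - 2 * log (P i i).re)
  · intro _ P o hp hm
    simp [logDet]
  · intro α _ ih inst P o hp hm
    classical
    obtain rfl : inst = Option.instDecidableEq := Subsingleton.elim _ _
    have hd1 : (P + diagonal fun i => (o i : ℂ)).submatrix some some
        = P.submatrix some some + diagonal fun i => (o (some i) : ℂ) := by
      ext i j; simp [diagonal_apply]
    have hd2 : (P - diagonal fun i => (o i : ℂ)).submatrix some some
        = P.submatrix some some - diagonal fun i => (o (some i) : ℂ) := by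
      ext i j; simp [diagonal_apply]
    have hP := posDef_of_add_sub hp hm
    have sp := hp.submatrix (Option.some_injective α)
    have sm := hm.submatrix (Option.some_injective α)
    rw [hd1] at sp
    rw [hd2] at sm
    obtain ⟨hp1, hp2⟩ := hp.logDet_option
    obtain ⟨hm1, hm2⟩ := hm.logDet_option
    obtain ⟨h1, h2⟩ := hP.logDet_option
    rw [hd1] at hp1 hp2
    rw [hd2] at hm1 hm2
    simp only [add_apply, sub_apply, diagonal_apply_eq, diagonal_apply_ne _ (Option.some_ne_none _),
      add_zero, sub_zero, Complex.add_re, Complex.sub_re, Complex.ofReal_re] at hp1 hp2 hm1 hm2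
    -- The direction is diagonal, so the three matrices share the same border column. The Schur
    -- complements are then `p - a`, `p + o - b` and `p - o - c`, with `a² ≤ b c`.
    have sq := sq_inv_form_le (posDef_of_add_sub sp sm) sp sm fun i => P (some i) none
    have b0 := sp.inv_form_nonneg fun i => P (some i) none
    have c0 := sm.inv_form_nonneg fun i => P (some i) none
    have a0 := (posDef_of_add_sub sp sm).inv_form_nonneg fun i => P (some i) none
    have ihh := ih (P.submatrix some some) (fun i => o (some i)) sp sm
    rw [hp2, hm2, h2, Fintype.sum_option]
    set p := (P none none).re
    set a := (star (fun i => P (some i) none) ⬝ᵥ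
          ((P.submatrix some some)⁻¹ *ᵥ fun i => P (some i) none)).re
    set b := (star (fun i => P (some i) none) ⬝ᵥ
      ((P.submatrix some some + diagonal fun i => (o (some i) : ℂ))⁻¹ *ᵥ
        fun i => P (some i) none)).re
    set c := (star (fun i => P (some i) none) ⬝ᵥ
      ((P.submatrix some some - diagonal fun i => (o (some i) : ℂ))⁻¹ *ᵥ
        fun i => P (some i) none)).re
    have key := schur_step_le (p := p) (o := o none) a0 b0 c0 sq (by linarith) (by linarith)
    have g1 : 0 < p + o none := by linarith
    have g2 : 0 < p - o none := by linarith
    have g3 : 0 < p := by linarith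
    have lk := log_le_log (by positivity) key
    rw [log_mul (by positivity) (by positivity), log_mul (by positivity) (by positivity),
      log_mul (by positivity) (by positivity), log_mul (by positivity) (by positivity),
      log_pow, log_pow] at lk
    push_cast at lk
    simp only [submatrix_apply] at ihh
    linarith

end Matrix

/-! ### Spectral sums and the entropy of a sum of two reflected matrices -/

namespace Matrix

section SpecSum

variable {n : Type*} [Fintype n] [DecidableEq n]

/-- The sum of a real function over the eigenvalues of a matrix, counted with multiplicity. -/
noncomputable def specSum (g : ℝ → ℝ) (X : Matrix n n ℂ) : ℝ :=
  (X.charpoly.roots.map fun z => g z.re).sum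

lemma specSum_congr_charpoly {m : Type*} [Fintype m] [DecidableEq m] {X : Matrix n n ℂ}
    {Y : Matrix m m ℂ} (h : X.charpoly = Y.charpoly) (g : ℝ → ℝ) : specSum g X = specSum g Y := by
  rw [specSum, specSum, h]

lemma IsHermitian.specSum_eq {X : Matrix n n ℂ} (hX : X.IsHermitian) (g : ℝ → ℝ) :
    specSum g X = ∑ i, g (hX.eigenvalues i) := by
  rw [specSum, hX.roots_charpoly_eq_eigenvalues, Multiset.map_map]
  rfl

lemma specSum_of_charpoly_eq_prod {X : Matrix n n ℂ} {l : n → ℝ}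
    (h : X.charpoly = ∏ i, (Polynomial.X - Polynomial.C (l i : ℂ))) (g : ℝ → ℝ) :
    specSum g X = ∑ i, g (l i) := by
  rw [specSum, h, Polynomial.roots_prod]
  · simp
  · exact Finset.prod_ne_zero_iff.mpr fun i _ => Polynomial.X_sub_C_ne_zero _

lemma specSum_diagonal (l : n → ℝ) (g : ℝ → ℝ) :
    specSum g (diagonal fun i => (l i : ℂ)) = ∑ i, g (l i) :=
  specSum_of_charpoly_eq_prod (charpoly_diagonal _) g

lemma IsHermitian.specSum_cfc {X : Matrix n n ℂ} (hX : X.IsHermitian) (f g : ℝ → ℝ) :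
    specSum g (cfc f X) = specSum (fun x => g (f x)) X := by
  rw [specSum_of_charpoly_eq_prod (l := fun i => f (hX.eigenvalues i)) (hX.charpoly_cfc_eq f),
    hX.specSum_eq]

lemma isHermitian_cfc (f : ℝ → ℝ) (X : Matrix n n ℂ) : (cfc f X).IsHermitian :=
  cfc_predicate f X

lemma IsHermitian.trace_cfc {X : Matrix n n ℂ} (hX : X.IsHermitian) (f : ℝ → ℝ) :
    (cfc f X).trace = specSum f X := by
  rw [hX.cfc_eq f, IsHermitian.cfc, Unitary.conjStarAlgAut_apply, trace_mul_cycle,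
    Unitary.coe_star_mul_self, one_mul, trace_diagonal, hX.specSum_eq]
  simp

lemma cfc_continuousOn (f : ℝ → ℝ) (X : Matrix n n ℂ) : ContinuousOn f (spectrum ℝ X) :=
  (Matrix.finite_real_spectrum (A := X)).continuousOn f

lemma IsHermitian.cfc_self {X : Matrix n n ℂ} (hX : X.IsHermitian) :
    cfc (fun x : ℝ => x) X = X := cfc_id' ℝ X hX

lemma cfc_mul_apply (f g : ℝ → ℝ) (X : Matrix n n ℂ) :
    cfc (fun x => f x * g x) X = cfc f X * cfc g X :=
  cfc_mul f g X (cfc_continuousOn _ _) (cfc_continuousOn _ _)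

lemma IsHermitian.cfc_add_const {X : Matrix n n ℂ} (hX : X.IsHermitian) (s : ℝ) :
    cfc (fun x : ℝ => x + s) X = X + algebraMap ℝ _ s :=
  (_root_.cfc_add_const s (fun x : ℝ => x) X (cfc_continuousOn _ _) hX).trans
    (congrArg (· + algebraMap ℝ _ s) hX.cfc_self)

lemma IsHermitian.trace_eq_specSum {X : Matrix n n ℂ} (hX : X.IsHermitian) :
    X.trace = specSum (fun x => x) X := by
  rw [← hX.trace_cfc, hX.cfc_self]

lemma IsHermitian.trace_sq_eq_specSum {X : Matrix n n ℂ} (hX : X.IsHermitian) :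
    (X * X).trace = specSum (fun x => x ^ 2) X := by
  simp only [sq]
  rw [← hX.trace_cfc, cfc_mul_apply, hX.cfc_self]

lemma specSum_submatrix {m : Type*} [Fintype m] [DecidableEq m] (X : Matrix n n ℂ) (e : m ≃ n)
    (g : ℝ → ℝ) : specSum g (X.submatrix e e) = specSum g X :=
  specSum_congr_charpoly (charpoly_reindex e.symm X) g

lemma specSum_fromBlocks {m : Type*} [Fintype m] [DecidableEq m] (A : Matrix m m ℂ)
    (B : Matrix n n ℂ) (g : ℝ → ℝ) :
    specSum g (fromBlocks A 0 0 B) = specSum g A + specSum g B := by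
  rw [specSum, charpoly_fromBlocks_zero₁₂, Polynomial.roots_mul, Multiset.map_add,
    Multiset.sum_add]
  · rfl
  · exact mul_ne_zero (charpoly_monic A).ne_zero (charpoly_monic B).ne_zero

lemma charpoly_unitary_conj (W : unitaryGroup n ℂ) (X : Matrix n n ℂ) :
    (star (W : Matrix n n ℂ) * X * (W : Matrix n n ℂ)).charpoly = X.charpoly := by
  rw [mul_assoc, charpoly_mul_comm, mul_assoc, Unitary.mul_star_self_of_mem W.2, mul_one]

lemma specSum_add (f g : ℝ → ℝ) (X : Matrix n n ℂ) :
    specSum (fun x => f x + g x) X = specSum f X + specSum g X :=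
  Multiset.sum_map_add

lemma specSum_const_mul (c : ℝ) (g : ℝ → ℝ) (X : Matrix n n ℂ) :
    specSum (fun x => c * g x) X = c * specSum g X :=
  Multiset.sum_map_mul_left

lemma IsHermitian.specSum_congr {X : Matrix n n ℂ} (hX : X.IsHermitian) {f g : ℝ → ℝ}
    (h : ∀ i, f (hX.eigenvalues i) = g (hX.eigenvalues i)) : specSum f X = specSum g X := by
  rw [hX.specSum_eq, hX.specSum_eq]
  exact Finset.sum_congr rfl fun i _ => h i

omit [Fintype n] in
lemma PosSemidef.add_smul_one {X : Matrix n n ℂ} (hX : X.PosSemidef) {s : ℝ} (hs : 0 < s) :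
    (X + (s : ℂ) • (1 : Matrix n n ℂ)).PosDef :=
  PosDef.posSemidef_add hX (PosDef.one.smul (by exact_mod_cast hs))

lemma PosSemidef.logDet_add_smul_one {X : Matrix n n ℂ} (hX : X.PosSemidef) {s : ℝ} (hs : 0 < s) :
    logDet (X + (s : ℂ) • (1 : Matrix n n ℂ)) = specSum (fun x => log (x + s)) X := by
  have e : X + (s : ℂ) • (1 : Matrix n n ℂ) = cfc (fun x : ℝ => x + s) X := by
    rw [hX.1.cfc_add_const, Algebra.algebraMap_eq_smul_one]
    rfl
  have hdet : (X + (s : ℂ) • (1 : Matrix n n ℂ)).det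
      = ((∏ i, (hX.1.eigenvalues i + s) : ℝ) : ℂ) := by
    rw [e, hX.1.cfc_eq, IsHermitian.cfc, Unitary.conjStarAlgAut_apply, det_mul_right_comm,
      Unitary.mul_star_self_of_mem (SetLike.coe_mem _), one_mul, det_diagonal]
    simp
  rw [logDet, hdet, Complex.ofReal_re, log_prod fun i _ =>
    (add_pos_of_nonneg_of_pos (hX.eigenvalues_nonneg i) hs).ne', hX.1.specSum_eq]

omit [DecidableEq n] in
lemma trace_sq_eq_sum_normSq {X : Matrix n n ℂ} (hX : X.IsHermitian) :
    (X * X).trace.re = ∑ i, ∑ j, Complex.normSq (X i j) := by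
  simp only [trace, diag_apply, mul_apply, Complex.re_sum]
  refine Finset.sum_congr rfl fun i _ => Finset.sum_congr rfl fun j _ => ?_
  rw [← hX.apply j i, Complex.star_def, Complex.mul_conj, Complex.ofReal_re]

omit [DecidableEq n] in
lemma sum_diag_sq_le {X : Matrix n n ℂ} (hX : X.IsHermitian) :
    ∑ i, (X i i).re ^ 2 ≤ (X * X).trace.re := by
  rw [trace_sq_eq_sum_normSq hX]
  refine Finset.sum_le_sum fun i _ => ?_
  refine le_trans ?_ (Finset.single_le_sum (fun j _ => Complex.normSq_nonneg (X i j))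
    (Finset.mem_univ i))
  rw [Complex.normSq_apply]
  nlinarith [mul_self_nonneg (X i i).im]

end SpecSum

variable {n : Type*} [Fintype n] [DecidableEq n]

/-- The differential form at `p = 2` of the optimal 2-uniform convexity inequality: if `D + O` and
`D - O` are positive semidefinite with the same spectrum, then the entropy of `(D + O)²` is at most
the sum of the entropies of `D²` and `O²` plus `2 tr O²`. -/
theorem specSum_sq_log_add_le {D O : Matrix n n ℂ} (hD : D.IsHermitian) (hO : O.IsHermitian)
    (hp : (D + O).PosSemidef) (hm : (D - O).PosSemidef)
    (hchar : (D - O).charpoly = (D + O).charpoly) :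
    2 * specSum (fun x => x ^ 2 * log x) (D + O)
      ≤ 2 * specSum (fun x => x ^ 2 * log x) D + 2 * specSum (fun x => x ^ 2 * log x) O
        + (((D * D).trace.re + (O * O).trace.re) * log ((D * D).trace.re + (O * O).trace.re)
          - (D * D).trace.re * log (D * D).trace.re - (O * O).trace.re * log (O * O).trace.re)
        + 2 * (O * O).trace.re := by
  set W := hO.eigenvectorUnitary
  set o := hO.eigenvalues with ho
  set D' := star (W : Matrix n n ℂ) * D * (W : Matrix n n ℂ) with hD'
  have hWO : star (W : Matrix n n ℂ) * O * (W : Matrix n n ℂ) = diagonal fun i => (o i : ℂ) := by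
    have := hO.conjStarAlgAut_star_eigenvectorUnitary
    rwa [Unitary.conjStarAlgAut_star_apply] at this
  have hW1 : star (W : Matrix n n ℂ) * (W : Matrix n n ℂ) = 1 := Unitary.coe_star_mul_self W
  have hp' : D' + diagonal (fun i => (o i : ℂ))
      = star (W : Matrix n n ℂ) * (D + O) * (W : Matrix n n ℂ) := by
    rw [hD', ← hWO, Matrix.mul_add, Matrix.add_mul]
  have hm' : D' - diagonal (fun i => (o i : ℂ))
      = star (W : Matrix n n ℂ) * (D - O) * (W : Matrix n n ℂ) := by
    rw [hD', ← hWO, Matrix.mul_sub, Matrix.sub_mul]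
  have hpp : (D' + diagonal (fun i => (o i : ℂ))).PosSemidef := by
    rw [hp']; exact hp.conjTranspose_mul_mul_same _
  have hmm : (D' - diagonal (fun i => (o i : ℂ))).PosSemidef := by
    rw [hm']; exact hm.conjTranspose_mul_mul_same _
  have hDp : D.PosSemidef := by
    have : D = (1 / 2 : ℝ) • ((D + O) + (D - O)) := by
      rw [add_add_sub_cancel, ← two_smul ℝ, smul_smul]; norm_num
    rw [this]
    exact (hp.add hm).smul (by norm_num)
  have hDp' : D'.PosSemidef := hDp.conjTranspose_mul_mul_same _
  set d : n → ℝ := fun i => (D' i i).re with hd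
  have hod : ∀ i, |o i| ≤ d i := by
    intro i
    have h1 := (Complex.le_def.1 (hpp.diag_nonneg (i := i))).1
    have h2 := (Complex.le_def.1 (hmm.diag_nonneg (i := i))).1
    simp only [add_apply, sub_apply, diagonal_apply_eq, Complex.add_re, Complex.sub_re,
      Complex.ofReal_re, Complex.zero_re] at h1 h2
    rw [abs_le]; constructor <;> linarith
  -- traces
  have trO : O.trace = 0 := by
    have h1 := hp.1.trace_eq_specSum
    rw [← specSum_congr_charpoly hchar, ← hm.1.trace_eq_specSum, trace_add, trace_sub] at h1
    have : (2 : ℂ) * O.trace = 0 := by linear_combination h1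
    simpa using this
  have trDO : ((D + O) * (D + O)).trace = (D * D).trace + (O * O).trace := by
    have h1 := hp.1.trace_sq_eq_specSum
    rw [← specSum_congr_charpoly hchar, ← hm.1.trace_sq_eq_specSum] at h1
    simp only [Matrix.add_mul, Matrix.mul_add, Matrix.sub_mul, Matrix.mul_sub, trace_add,
      trace_sub] at h1 ⊢
    linear_combination (1 / 2 : ℂ) * h1
  have sumd : ∑ i, d i ^ 2 ≤ (D * D).trace.re := by
    refine (sum_diag_sq_le hDp'.1).trans_eq ?_
    rw [hDp'.1.trace_sq_eq_specSum, hD.trace_sq_eq_specSum,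
      specSum_congr_charpoly (charpoly_unitary_conj W D)]
  have sumo : ∑ i, o i ^ 2 = (O * O).trace.re := by
    rw [hO.trace_sq_eq_specSum, hO.specSum_eq, Complex.ofReal_re]
  -- comparison with the scalar second difference
  have key : 2 * specSum (fun x => x ^ 2 * log x) (D + O) - 2 * specSum (fun x => x ^ 2 * log x) D
      ≤ ∑ i, ((d i + o i) ^ 2 * log (d i + o i) + (d i - o i) ^ 2 * log (d i - o i)
        - 2 * (d i ^ 2 * log (d i))) := by
    -- The signed measure is the matrix second difference minus the scalar one. The eigenvalues of
    -- `D + O` have weight `2`, standing also for those of `D - O`, and those of `D` have weight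
    -- `-2`; the points `d ± o` have weight `-1` and `d` has weight `2`.
    have h := sum_sq_mul_log_nonpos (J := n × Fin 5)
      (fun j => ![2, -2, -1, -1, 2] j.2)
      (fun j => ![hp.1.eigenvalues j.1, hD.eigenvalues j.1, d j.1 + o j.1, d j.1 - o j.1,
        d j.1] j.2) ?_ ?_ ?_ ?_ ?_
    · simp only [Fintype.sum_prod_type, Fin.sum_univ_five] at h
      simp only [Fin.isValue, Matrix.cons_val, Finset.sum_add_distrib,
        ← Finset.mul_sum, ← hp.1.specSum_eq (fun x => x ^ 2 * log x),
        ← hD.specSum_eq (fun x => x ^ 2 * log x)] at h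
      simp only [Finset.sum_add_distrib, Finset.sum_sub_distrib, ← Finset.mul_sum]
      linarith
    · rintro ⟨i, j⟩
      have := abs_le.1 (hod i)
      fin_cases j
      · exact hp.eigenvalues_nonneg i
      · exact hDp.eigenvalues_nonneg i
      · change 0 ≤ d i + o i; linarith
      · change 0 ≤ d i - o i; linarith
      · exact (abs_nonneg _).trans (hod i)
    · simp only [Fintype.sum_prod_type, Fin.sum_univ_five]
      refine Finset.sum_eq_zero fun i _ => ?_
      simp only [Fin.isValue, Matrix.cons_val]
      norm_num
    · have : specSum (fun x => x) (D + O) = specSum (fun x => x) D := by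
        have := hp.1.trace_eq_specSum
        rw [trace_add, trO, add_zero, hD.trace_eq_specSum] at this
        exact_mod_cast this.symm
      rw [hp.1.specSum_eq, hD.specSum_eq] at this
      simp only [Fintype.sum_prod_type, Fin.sum_univ_five, Fin.isValue, Matrix.cons_val]
      simp only [Finset.sum_add_distrib, ← Finset.mul_sum, Finset.sum_sub_distrib]
      linarith
    · have : specSum (fun x => x ^ 2) (D + O)
          = specSum (fun x => x ^ 2) D + specSum (fun x => x ^ 2) O := by
        have := hp.1.trace_sq_eq_specSum
        rw [trDO, hD.trace_sq_eq_specSum, hO.trace_sq_eq_specSum] at this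
        exact_mod_cast this.symm
      rw [hp.1.specSum_eq, hD.specSum_eq, hO.specSum_eq] at this
      simp only [Fintype.sum_prod_type, Fin.sum_univ_five, Fin.isValue, Matrix.cons_val]
      have e : ∀ i, 2 * hp.1.eigenvalues i ^ 2 + -2 * hD.eigenvalues i ^ 2
          + -1 * (d i + o i) ^ 2 + -1 * (d i - o i) ^ 2 + 2 * d i ^ 2
          = 2 * hp.1.eigenvalues i ^ 2 - 2 * hD.eigenvalues i ^ 2 - 2 * o i ^ 2 := fun i => by ring
      simp only [e, Finset.sum_sub_distrib, ← Finset.mul_sum]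
      linarith
    -- The shift by `s > 0` makes the semidefinite matrices definite, so the `log det` comparison
    -- applies at every `s`.
    · intro s hs
      have eP : D' + (s : ℂ) • (1 : Matrix n n ℂ) + diagonal (fun i => (o i : ℂ))
          = D' + diagonal (fun i => (o i : ℂ)) + (s : ℂ) • (1 : Matrix n n ℂ) := by abel
      have eM : D' + (s : ℂ) • (1 : Matrix n n ℂ) - diagonal (fun i => (o i : ℂ))
          = D' - diagonal (fun i => (o i : ℂ)) + (s : ℂ) • (1 : Matrix n n ℂ) := by abel
      have h := logDet_second_difference_le n (D' + (s : ℂ) • (1 : Matrix n n ℂ)) o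
        (by rw [eP]; exact hpp.add_smul_one hs) (by rw [eM]; exact hmm.add_smul_one hs)
      rw [eP, eM, hpp.logDet_add_smul_one hs, hmm.logDet_add_smul_one hs,
        hDp'.logDet_add_smul_one hs, hp', hm', hD',
        specSum_congr_charpoly (charpoly_unitary_conj W _),
        specSum_congr_charpoly (charpoly_unitary_conj W _),
        specSum_congr_charpoly (charpoly_unitary_conj W _), ← hD',
        specSum_congr_charpoly hchar, hp.1.specSum_eq, hD.specSum_eq] at h
      have e : ∀ i, ((D' + (s : ℂ) • (1 : Matrix n n ℂ)) i i).re = d i + s := fun i => by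
        simp [hd]
      simp only [e, Finset.sum_add_distrib, Finset.sum_sub_distrib, ← Finset.mul_sum] at h
      simp only [Fintype.sum_prod_type, Fin.sum_univ_five, Fin.isValue, Matrix.cons_val]
      simp only [Finset.sum_add_distrib, ← Finset.mul_sum]
      have e1 : ∀ i, d i + o i + s = d i + s + o i := fun i => by ring
      have e2 : ∀ i, d i - o i + s = d i + s - o i := fun i => by ring
      simp only [e1, e2]
      linarith
  have hs := sum_sq_log_split_le d o hod sumd sumo
  have : ∑ i, o i ^ 2 * log (o i) = specSum (fun x => x ^ 2 * log x) O := by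
    rw [hO.specSum_eq]
  rw [this] at hs
  linarith

end Matrix

/-! ### Functional calculus and traces -/

namespace Matrix

variable {n : Type*} [Fintype n] [DecidableEq n]

lemma IsHermitian.cfc_congr_eigenvalues {X : Matrix n n ℂ} (hX : X.IsHermitian) {f g : ℝ → ℝ}
    (h : ∀ i, f (hX.eigenvalues i) = g (hX.eigenvalues i)) : cfc f X = cfc g X := by
  rw [hX.cfc_eq, hX.cfc_eq, IsHermitian.cfc, IsHermitian.cfc]
  congr 2
  funext i
  simp [h]

lemma IsHermitian.posSemidef_cfc {X : Matrix n n ℂ} (hX : X.IsHermitian) {f : ℝ → ℝ}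
    (h : ∀ x, 0 ≤ f x) : (cfc f X).PosSemidef := by
  rw [hX.cfc_eq, IsHermitian.cfc, Unitary.conjStarAlgAut_apply]
  refine PosSemidef.mul_mul_conjTranspose_same (PosSemidef.diagonal fun i => ?_) _
  exact Complex.zero_le_real.2 (h _)

lemma cfc_add_apply (f g : ℝ → ℝ) (X : Matrix n n ℂ) :
    cfc (fun x => f x + g x) X = cfc f X + cfc g X :=
  cfc_add X f g (cfc_continuousOn _ _) (cfc_continuousOn _ _)

lemma cfc_sub_apply (f g : ℝ → ℝ) (X : Matrix n n ℂ) :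
    cfc (fun x => f x - g x) X = cfc f X - cfc g X :=
  cfc_sub f g X (cfc_continuousOn _ _) (cfc_continuousOn _ _)

lemma IsHermitian.cfc_comp_apply {X : Matrix n n ℂ} (hX : X.IsHermitian) (g f : ℝ → ℝ) :
    cfc (fun x => g (f x)) X = cfc g (cfc f X) :=
  cfc_comp g f X hX (((Matrix.finite_real_spectrum (A := X)).image f).continuousOn g)
    (cfc_continuousOn _ _)

/-- The absolute value of a Hermitian matrix commutes with everything that commutes with its
square. -/
lemma IsHermitian.commute_cfc_abs {X Z : Matrix n n ℂ} (hX : X.IsHermitian)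
    (h : Commute (X * X) Z) : Commute (cfc (fun x : ℝ => |x|) X) Z := by
  have e : cfc (fun x : ℝ => |x|) X = cfc (fun x : ℝ => √x) (X * X) := by
    have h2 : X * X = cfc (fun x : ℝ => x * x) X := by rw [cfc_mul_apply, hX.cfc_self]
    rw [h2, ← hX.cfc_comp_apply]
    simp only [sqrt_mul_self_eq_abs]
  rw [e]
  exact Commute.cfc_real h _

lemma PosSemidef.trace_mul_nonneg {A B : Matrix n n ℂ} (hA : A.PosSemidef) (hB : B.PosSemidef) :
    0 ≤ (A * B).trace.re := by
  have hC : (cfc (fun x : ℝ => √x) A)ᴴ = cfc (fun x : ℝ => √x) A := isHermitian_cfc _ A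
  have e : A = cfc (fun x : ℝ => √x) A * cfc (fun x : ℝ => √x) A := by
    rw [← cfc_mul_apply]
    conv_lhs => rw [← hA.1.cfc_self]
    exact hA.1.cfc_congr_eigenvalues fun i => (mul_self_sqrt (hA.eigenvalues_nonneg i)).symm
  rw [e, mul_assoc, trace_mul_comm]
  have := (hB.mul_mul_conjTranspose_same (cfc (fun x : ℝ => √x) A)).trace_nonneg
  rw [hC] at this
  exact (Complex.le_def.1 this).1

omit [DecidableEq n] in
/-- Cauchy-Schwarz in the form needed for norms of Hermitian matrices. -/
lemma sq_sqrt_trace_sub_le {A B : Matrix n n ℂ} (hA : A.IsHermitian) (hB : B.IsHermitian) :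
    (√(A * A).trace.re - √(B * B).trace.re) ^ 2 ≤ ((A - B) * (A - B)).trace.re := by
  have hnn : ∀ {X : Matrix n n ℂ}, X.IsHermitian → 0 ≤ (X * X).trace.re := fun hX => by
    rw [trace_sq_eq_sum_normSq hX]
    exact Finset.sum_nonneg fun i _ => Finset.sum_nonneg fun j _ => Complex.normSq_nonneg _
  have ha := hnn hA
  have hb := hnn hB
  have e : ∀ l : ℝ, (((A - (l : ℂ) • B) * (A - (l : ℂ) • B)).trace).re
      = (A * A).trace.re - 2 * l * (A * B).trace.re + l ^ 2 * (B * B).trace.re := fun l => by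
    rw [Matrix.mul_sub, Matrix.sub_mul, Matrix.sub_mul]
    simp only [Matrix.mul_smul, Matrix.smul_mul, trace_sub, trace_smul, smul_eq_mul,
      Complex.sub_re, Complex.re_ofReal_mul, trace_mul_comm B A]
    ring
  have hd := discrim_le_zero (a := (B * B).trace.re) (b := -(2 * (A * B).trace.re))
    (c := (A * A).trace.re) fun l => by
      have hl : (A - (l : ℂ) • B).IsHermitian := by
        refine hA.sub ?_
        rw [IsHermitian, conjTranspose_smul, hB.eq]; simp
      have := hnn hl
      rw [e] at this
      linarith
  rw [discrim] at hd
  have h1 := e 1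
  rw [Complex.ofReal_one, one_smul] at h1
  rw [h1, sub_sq, sq_sqrt ha, sq_sqrt hb]
  have : (A * B).trace.re ≤ √(A * A).trace.re * √(B * B).trace.re := by
    rw [← sqrt_mul ha]
    exact le_sqrt_of_sq_le (by nlinarith)
  linarith

end Matrix

/-! ### Site operators and blocks -/

namespace Qubits

open Matrix

/-- The map `f ↦ (tr f / 2) 𝟙` on one qubit. -/
noncomputable def depolarize : Module.End ℂ (Matrix (Fin 2) (Fin 2) ℂ) where
  toFun f := (f.trace / 2) • (1 : Matrix (Fin 2) (Fin 2) ℂ)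
  map_add' f g := by rw [trace_add, add_div, add_smul]
  map_smul' c f := by
    simp only [trace_smul, smul_eq_mul, RingHom.id_apply, mul_div_assoc, mul_smul]

variable {N : ℕ}

/-- Full depolarization of the qubit at site `k`. -/
noncomputable def siteExp (k : Fin N) :
    Module.End ℂ (Matrix (Fin N → Fin 2) (Fin N → Fin 2) ℂ) :=
  atSite depolarize k

lemma siteExp_apply (k : Fin N) (X : Matrix (Fin N → Fin 2) (Fin N → Fin 2) ℂ)
    (x y : Fin N → Fin 2) :
    siteExp k X x y = if x k = y k then
      (∑ a, X (Function.update x k a) (Function.update y k a)) / 2 else 0 := by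
  change ((trace (of fun a b => X (Function.update x k a) (Function.update y k b)) / 2) •
    (1 : Matrix (Fin 2) (Fin 2) ℂ)) (x k) (y k) = _
  rw [Matrix.smul_apply, one_apply, smul_eq_mul, mul_ite, mul_one, mul_zero]
  rfl

/-- Complete positivity in Kraus form: half the sum over `a`, `b` of the compressions, overwriting
bit `k` by `a` and then projecting onto bit `k` equal to `b`. -/
lemma siteExp_posSemidef (k : Fin N) {X : Matrix (Fin N → Fin 2) (Fin N → Fin 2) ℂ}
    (hX : X.PosSemidef) : (siteExp k X).PosSemidef := by
  have e : siteExp k X = (1 / 2 : ℝ) • ∑ a : Fin 2, ∑ b : Fin 2,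
      (diagonal fun x : Fin N → Fin 2 => if x k = b then (1 : ℂ) else 0)ᴴ *
        X.submatrix (fun x => Function.update x k a) (fun x => Function.update x k a) *
        (diagonal fun x : Fin N → Fin 2 => if x k = b then (1 : ℂ) else 0) := by
    ext x y
    rw [siteExp_apply, Matrix.smul_apply, Matrix.sum_apply]
    simp only [Matrix.sum_apply, diagonal_conjTranspose, mul_diagonal, diagonal_mul, submatrix_apply,
      Pi.star_apply]
    simp only [Fin.sum_univ_two]
    generalize x k = u
    generalize y k = v
    fin_cases u <;> fin_cases v <;> simp [Complex.real_smul] <;> ring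
  rw [e]
  refine PosSemidef.smul (posSemidef_sum _ fun a _ => posSemidef_sum _ fun b _ => ?_) (by norm_num)
  exact (hX.submatrix _).conjTranspose_mul_mul_same _

/-- The Dirichlet form `tr X² - tr (X E_k(X))` of a single site. -/
noncomputable def siteForm (k : Fin N) (X : Matrix (Fin N → Fin 2) (Fin N → Fin 2) ℂ) : ℝ :=
  (X * X).trace.re - (X * siteExp k X).trace.re

/-- Replacing a Hermitian matrix by its absolute value does not increase the Dirichlet form. -/
lemma siteForm_abs_le (k : Fin N) {X : Matrix (Fin N → Fin 2) (Fin N → Fin 2) ℂ}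
    (hX : X.IsHermitian) : siteForm k (cfc (fun x : ℝ => |x|) X) ≤ siteForm k X := by
  set R := cfc (fun x : ℝ => |x|) X with hR
  have h1 : (R - X).PosSemidef := by
    have := hX.posSemidef_cfc (f := fun x => |x| - x) fun x => sub_nonneg.2 (le_abs_self x)
    rwa [cfc_sub_apply, hX.cfc_self] at this
  have h2 : (R + X).PosSemidef := by
    have := hX.posSemidef_cfc (f := fun x => |x| + x) fun x => by linarith [neg_abs_le x]
    rwa [cfc_add_apply, hX.cfc_self] at this
  have h3 : R * R = X * X := by
    rw [hR, ← cfc_mul_apply]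
    conv_rhs => rw [← hX.cfc_self, ← cfc_mul_apply]
    simp only [abs_mul_abs_self]
  -- Adding the two inequalities cancels the mixed terms and leaves `tr (X E_k X) ≤ tr (R E_k R)`,
  -- while `R² = X²`.
  have t1 := h1.trace_mul_nonneg (siteExp_posSemidef k h2)
  have t2 := h2.trace_mul_nonneg (siteExp_posSemidef k h1)
  rw [siteForm, siteForm, h3]
  simp only [map_add, map_sub, Matrix.add_mul, Matrix.mul_add, Matrix.sub_mul, Matrix.mul_sub,
    trace_add, trace_sub, Complex.add_re, Complex.sub_re] at t1 t2
  linarith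

/-! ### Block decomposition with respect to the first qubit. -/

/-- Splitting off the first qubit. -/
def splitFirst (N : ℕ) : (Fin N → Fin 2) ⊕ (Fin N → Fin 2) ≃ (Fin (N + 1) → Fin 2) :=
  ((Equiv.boolProdEquivSum _).symm.trans (Equiv.prodCongr finTwoEquiv.symm (Equiv.refl _))).trans
    (Fin.consEquiv fun _ => Fin 2)

/-- The block of a matrix on `N + 1` qubits with fixed values of the first qubit. -/
def block (a b : Fin 2) (X : Matrix (Fin (N + 1) → Fin 2) (Fin (N + 1) → Fin 2) ℂ) :
    Matrix (Fin N → Fin 2) (Fin N → Fin 2) ℂ :=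
  X.submatrix (fun x => (Fin.cons a x : Fin (N + 1) → Fin 2))
    (fun x => (Fin.cons b x : Fin (N + 1) → Fin 2))

lemma sum_splitFirst {M : Type*} [AddCommMonoid M] (g : (Fin (N + 1) → Fin 2) → M) :
    ∑ x, g x = ∑ x : Fin N → Fin 2, g (Fin.cons 0 x) + ∑ x : Fin N → Fin 2, g (Fin.cons 1 x) := by
  rw [← (splitFirst N).sum_comp, Fintype.sum_sum_type]
  rfl

lemma trace_mul_block (X Y : Matrix (Fin (N + 1) → Fin 2) (Fin (N + 1) → Fin 2) ℂ) :
    (X * Y).trace = (block 0 0 X * block 0 0 Y).trace + (block 0 1 X * block 1 0 Y).trace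
      + (block 1 0 X * block 0 1 Y).trace + (block 1 1 X * block 1 1 Y).trace := by
  simp only [trace, diag_apply, mul_apply, sum_splitFirst, Finset.sum_add_distrib]
  simp only [block, submatrix_apply]
  ring

lemma block_mul (a b : Fin 2) (X Y : Matrix (Fin (N + 1) → Fin 2) (Fin (N + 1) → Fin 2) ℂ) :
    block a b (X * Y) = block a 0 X * block 0 b Y + block a 1 X * block 1 b Y := by
  ext x y
  simp only [block, submatrix_apply, mul_apply, Matrix.add_apply, sum_splitFirst]

lemma block_siteExp_succ (a b : Fin 2) (k : Fin N)
    (X : Matrix (Fin (N + 1) → Fin 2) (Fin (N + 1) → Fin 2) ℂ) :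
    block a b (siteExp k.succ X) = siteExp k (block a b X) := by
  ext x y
  simp only [block, submatrix_apply, siteExp_apply, Fin.cons_succ, ← Fin.cons_update]

lemma block_siteExp_zero (a b : Fin 2)
    (X : Matrix (Fin (N + 1) → Fin 2) (Fin (N + 1) → Fin 2) ℂ) :
    block a b (siteExp 0 X)
      = if a = b then (1 / 2 : ℂ) • (block 0 0 X + block 1 1 X) else 0 := by
  ext x y
  simp only [block, submatrix_apply, siteExp_apply, Fin.cons_zero, Fin.update_cons_zero,
    Fin.sum_univ_two]
  split_ifs
  · simp; ring
  · rfl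

/-- The form of a site other than the first, in terms of blocks. -/
lemma siteForm_succ (k : Fin N) (X : Matrix (Fin (N + 1) → Fin 2) (Fin (N + 1) → Fin 2) ℂ) :
    siteForm k.succ X = siteForm k (block 0 0 X) + siteForm k (block 1 1 X)
      + (((block 0 1 X * block 1 0 X).trace + (block 1 0 X * block 0 1 X).trace).re
        - ((block 0 1 X * siteExp k (block 1 0 X)).trace
          + (block 1 0 X * siteExp k (block 0 1 X)).trace).re) := by
  simp only [siteForm, trace_mul_block, block_siteExp_succ, Complex.add_re]
  ring

/-- Depolarizing the first qubit replaces both diagonal blocks by their mean and deletes the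
off-diagonal blocks. -/
lemma siteForm_zero (X : Matrix (Fin (N + 1) → Fin 2) (Fin (N + 1) → Fin 2) ℂ) :
    2 * siteForm 0 X
      = ((block 0 0 X - block 1 1 X) * (block 0 0 X - block 1 1 X)).trace.re
        + 2 * ((block 0 1 X * block 1 0 X).trace + (block 1 0 X * block 0 1 X).trace).re := by
  have e : (block 0 0 X * block 1 1 X).trace = (block 1 1 X * block 0 0 X).trace :=
    trace_mul_comm _ _
  simp only [siteForm, trace_mul_block, block_siteExp_zero, if_true, zero_ne_one, one_ne_zero,
    if_false, Matrix.mul_zero, trace_zero, Matrix.mul_smul, Matrix.sub_mul, Matrix.mul_sub,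
    Matrix.mul_add, trace_smul, trace_add, trace_sub, smul_eq_mul, e]
  simp only [Complex.add_re, Complex.sub_re, Complex.mul_re, Complex.add_im, Complex.zero_re]
  norm_num
  ring

lemma block_isHermitian {X : Matrix (Fin (N + 1) → Fin 2) (Fin (N + 1) → Fin 2) ℂ}
    (h : X.IsHermitian) (a : Fin 2) : (block a a X).IsHermitian :=
  h.submatrix _

lemma block_posSemidef {X : Matrix (Fin (N + 1) → Fin 2) (Fin (N + 1) → Fin 2) ℂ}
    (h : X.PosSemidef) (a : Fin 2) : (block a a X).PosSemidef :=
  h.submatrix _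

lemma specSum_block {X : Matrix (Fin (N + 1) → Fin 2) (Fin (N + 1) → Fin 2) ℂ}
    (h01 : block 0 1 X = 0) (h10 : block 1 0 X = 0) (g : ℝ → ℝ) :
    specSum g X = specSum g (block 0 0 X) + specSum g (block 1 1 X) := by
  rw [← specSum_submatrix X (splitFirst N), ← specSum_fromBlocks]
  congr 1
  ext i j
  rcases i with i | i <;> rcases j with j | j
  · rfl
  · exact congrFun (congrFun h01 i) j
  · exact congrFun (congrFun h10 i) j
  · rfl

/-- The reflection `σ_z` of the first qubit. -/
def signFirst (N : ℕ) : Matrix (Fin (N + 1) → Fin 2) (Fin (N + 1) → Fin 2) ℂ :=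
  diagonal fun x => if x 0 = 0 then 1 else -1

lemma signFirst_mul_self : signFirst N * signFirst N = 1 := by
  rw [signFirst, diagonal_mul_diagonal, ← diagonal_one]
  congr 1
  funext x
  split_ifs <;> norm_num

lemma block_signFirst_conj (a b : Fin 2)
    (X : Matrix (Fin (N + 1) → Fin 2) (Fin (N + 1) → Fin 2) ℂ) :
    block a b (signFirst N * X * signFirst N) = if a = b then block a b X else -block a b X := by
  ext x y
  simp only [block, signFirst, submatrix_apply, mul_diagonal, diagonal_mul, Fin.cons_zero]
  fin_cases a <;> fin_cases b <;> simp

lemma block_ext {X Y : Matrix (Fin (N + 1) → Fin 2) (Fin (N + 1) → Fin 2) ℂ}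
    (h : ∀ a b, block a b X = block a b Y) : X = Y := by
  ext x y
  rw [← Fin.cons_self_tail x, ← Fin.cons_self_tail y]
  exact congrFun (congrFun (h (x 0) (y 0)) (Fin.tail x)) (Fin.tail y)

end Qubits

/-! ### The logarithmic Sobolev inequality -/

namespace Qubits

open Matrix

variable {N : ℕ}

lemma trace_block_diag {X : Matrix (Fin (N + 1) → Fin 2) (Fin (N + 1) → Fin 2) ℂ}
    (h01 : block 0 1 X = 0) :
    (X * X).trace.re = (block 0 0 X * block 0 0 X).trace.re
      + (block 1 1 X * block 1 1 X).trace.re := by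
  rw [trace_mul_block, h01]
  simp

lemma siteForm_succ_block_diag (k : Fin N)
    {X : Matrix (Fin (N + 1) → Fin 2) (Fin (N + 1) → Fin 2) ℂ} (h01 : block 0 1 X = 0) :
    siteForm k.succ X = siteForm k (block 0 0 X) + siteForm k (block 1 1 X) := by
  rw [siteForm_succ, h01]
  simp

lemma trace_mul_self_nonneg {n : Type*} [Fintype n] {X : Matrix n n ℂ} (hX : X.IsHermitian) :
    0 ≤ (X * X).trace.re := by
  rw [trace_sq_eq_sum_normSq hX]
  exact Finset.sum_nonneg fun i _ => Finset.sum_nonneg fun j _ => Complex.normSq_nonneg _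

lemma mul_log_div (a d : ℝ) (hd : d ≠ 0) : a * log (a / d) = a * log a - a * log d := by
  rcases eq_or_ne a 0 with rfl | h
  · simp
  · rw [log_div h hd]; ring

/-- The quantum logarithmic Sobolev inequality on `N` qubits, for the unnormalised trace. -/
theorem logSobolev : ∀ (N : ℕ) (M : Matrix (Fin N → Fin 2) (Fin N → Fin 2) ℂ), M.PosSemidef →
    2 * specSum (fun x => x ^ 2 * log x) M - (M * M).trace.re * log ((M * M).trace.re / 2 ^ N)
      ≤ 2 * ∑ k, siteForm k M := by
  intro N
  induction N with
  | zero =>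
    intro M hM
    have e := hM.1.trace_sq_eq_specSum
    rw [hM.1.specSum_eq, Fintype.sum_unique] at e
    rw [e, Complex.ofReal_re, hM.1.specSum_eq, Fintype.sum_unique, pow_zero, div_one, log_pow,
      Fin.sum_univ_zero]
    push_cast
    linarith
  | succ N ih =>
    intro M hM
    -- Averaging over conjugation by `σ_z` keeps the diagonal blocks and removes the others, so that
    -- `D + O = M` and `D - O` is the unitary conjugate of `M`.
    set D := (1 / 2 : ℝ) • (M + signFirst N * M * signFirst N) with hDdef
    set O := (1 / 2 : ℝ) • (M - signFirst N * M * signFirst N) with hOdef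
    have hZ : (signFirst N)ᴴ = signFirst N := by
      rw [signFirst, diagonal_conjTranspose]
      congr 1
      funext x
      simp only [Pi.star_apply]
      split_ifs <;> simp
    have hZM : (signFirst N * M * signFirst N).PosSemidef := by
      have := hM.mul_mul_conjTranspose_same (signFirst N)
      rwa [hZ] at this
    have hD : D.IsHermitian := ((hM.add hZM).smul (by norm_num : (0 : ℝ) ≤ 1 / 2)).1
    have hO : O.IsHermitian := by
      rw [hOdef, IsHermitian, conjTranspose_smul, (hM.1.sub hZM.1).eq, star_trivial]
    have hadd : D + O = M := by
      rw [hDdef, hOdef, ← smul_add, add_add_sub_cancel, ← two_smul ℝ, smul_smul]; norm_num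
    have hsub : D - O = signFirst N * M * signFirst N := by
      rw [hDdef, hOdef, ← smul_sub, add_sub_sub_cancel, ← two_smul ℝ, smul_smul]; norm_num
    have bD : ∀ a b, block a b D = if a = b then block a b M else 0 := fun a b => by
      have : block a b D = (1 / 2 : ℝ) • (block a b M
        + block a b (signFirst N * M * signFirst N)) := rfl
      rw [this, block_signFirst_conj]
      split_ifs
      · rw [← two_smul ℝ, smul_smul]; norm_num
      · rw [add_neg_cancel, smul_zero]
    have bO : ∀ a b, block a b O = if a = b then 0 else block a b M := fun a b => by
      have : block a b O = (1 / 2 : ℝ) • (block a b M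
        - block a b (signFirst N * M * signFirst N)) := rfl
      rw [this, block_signFirst_conj]
      split_ifs
      · rw [sub_self, smul_zero]
      · rw [sub_neg_eq_add, ← two_smul ℝ, smul_smul]; norm_num
    have hchar : (D - O).charpoly = (D + O).charpoly := by
      rw [hsub, hadd, mul_assoc, charpoly_mul_comm, mul_assoc, signFirst_mul_self, mul_one]
    have K := specSum_sq_log_add_le hD hO (hadd ▸ hM) (hsub ▸ hZM) hchar
    rw [hadd] at K
    -- the absolute value of the off-diagonal part
    set R := cfc (fun x : ℝ => |x|) O with hR
    have hRp : R.PosSemidef := hO.posSemidef_cfc fun x => abs_nonneg x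
    have hRR : R * R = O * O := by
      rw [hR, ← cfc_mul_apply]
      conv_rhs => rw [← hO.cfc_self, ← cfc_mul_apply]
      simp only [abs_mul_abs_self]
    -- `O` swaps the two blocks, so `O²` preserves them; hence so does `R = |O|`, a function of
    -- `O²`. This makes the induction hypothesis applicable to the blocks of `R`.
    have hcomm : Commute (O * O) (signFirst N) := by
      have hZO : signFirst N * (O * O) * signFirst N = O * O := by
        refine block_ext fun a b => ?_
        rw [block_signFirst_conj]
        split_ifs with h
        · rfl
        · rw [block_mul]
          fin_cases a <;> fin_cases b <;> simp [bO] at h ⊢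
      have := congrArg (· * signFirst N) hZO
      simp only [mul_assoc, signFirst_mul_self, mul_one] at this
      rw [Commute, SemiconjBy, mul_assoc, ← this]
    have hRcomm := hO.commute_cfc_abs hcomm
    have bR : ∀ a b, a ≠ b → block a b R = 0 := by
      intro a b hab
      have h1 : signFirst N * R * signFirst N = R := by
        rw [← hRcomm.eq, mul_assoc, signFirst_mul_self, mul_one]
      have h2 := block_signFirst_conj a b R
      rw [h1, if_neg hab] at h2
      ext x y
      exact self_eq_neg.1 (congrFun (congrFun h2 x) y)
    -- `Real.log` is even, so `x² log x` does not see the signs of the eigenvalues of `O`.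
    have hSR : specSum (fun x => x ^ 2 * log x) O = specSum (fun x => x ^ 2 * log x) R := by
      rw [hR, hO.specSum_cfc]
      simp only [sq_abs, log_abs]
    have hform := fun k => siteForm_abs_le k hO
    -- the two blocks of `R` carry the same weight
    have hr : (block 0 0 R * block 0 0 R).trace.re = (block 1 1 R * block 1 1 R).trace.re := by
      have e : ∀ a, block a a R * block a a R = block a a (O * O) := fun a => by
        rw [← hRR, block_mul]
        fin_cases a <;> simp [bR]
      rw [e, e, block_mul, block_mul, bO 0 0, bO 1 1]
      simp only [if_true, zero_mul, zero_add, add_zero]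
      rw [trace_mul_comm]
    have hV : (O * O).trace.re = 2 * (block 0 0 R * block 0 0 R).trace.re := by
      rw [← hRR, trace_block_diag (bR 0 1 (by decide)), ← hr]; ring
    have hU := trace_block_diag (X := D) (by simp [bD])
    have bD0 : block 0 0 D = block 0 0 M := by simp [bD]
    have bD1 : block 1 1 D = block 1 1 M := by simp [bD]
    have ihA := ih (block 0 0 M) (block_posSemidef hM 0)
    have ihB := ih (block 1 1 M) (block_posSemidef hM 1)
    have ih0 := ih (block 0 0 R) (block_posSemidef hRp 0)
    have ih1 := ih (block 1 1 R) (block_posSemidef hRp 1)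
    have hSD := specSum_block (X := D) (by simp [bD]) (by simp [bD]) (fun x => x ^ 2 * log x)
    have hSR' := specSum_block (bR 0 1 (by decide)) (bR 1 0 (by decide)) (fun x => x ^ 2 * log x)
    have hMM : (M * M).trace.re = (D * D).trace.re + (O * O).trace.re := by
      rw [trace_mul_block M M, trace_mul_block D D, trace_mul_block O O]
      simp [bD, bO]
      ring
    -- A site other than the first acts blockwise, so its form at `M` is the sum of its forms at `D`
    -- and at `O`; the latter dominates the form at `R`.
    have hsucc : ∀ k : Fin N, siteForm k (block 0 0 M) + siteForm k (block 1 1 M)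
        + (siteForm k (block 0 0 R) + siteForm k (block 1 1 R)) ≤ siteForm k.succ M := by
      intro k
      have h1 := hform k.succ
      rw [← hR, siteForm_succ_block_diag k (bR 0 1 (by decide)), siteForm_succ k O] at h1
      rw [siteForm_succ k M]
      simp only [bO, if_true, zero_ne_one, one_ne_zero, if_false] at h1
      have : siteForm k (0 : Matrix (Fin N → Fin 2) (Fin N → Fin 2) ℂ) = 0 := by
        simp [siteForm]
      rw [this] at h1
      linarith
    have hzero : 2 * siteForm 0 M
        = ((block 0 0 M - block 1 1 M) * (block 0 0 M - block 1 1 M)).trace.re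
          + 2 * (O * O).trace.re := by
      rw [siteForm_zero, trace_mul_block O O]
      simp [bO]
    -- The two-point inequality is applied to the norms of the diagonal blocks; the squared
    -- difference of these norms is at most the squared norm of the difference of the blocks, which
    -- occurs in the form of the first site.
    have hcs := sq_sqrt_trace_sub_le (block_isHermitian hM.1 0) (block_isHermitian hM.1 1)
    have ha := trace_mul_self_nonneg (block_isHermitian hM.1 0)
    have hb := trace_mul_self_nonneg (block_isHermitian hM.1 1)
    have htp := two_point_logSobolev' (sqrt_nonneg (block 0 0 M * block 0 0 M).trace.re)
      (sqrt_nonneg (block 1 1 M * block 1 1 M).trace.re)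
    rw [sq_sqrt ha, sq_sqrt hb] at htp
    have hsum := Finset.sum_le_sum fun k (_ : k ∈ Finset.univ) => hsucc k
    simp only [Finset.sum_add_distrib] at hsum
    rw [Fin.sum_univ_succ]
    have h2N : (2 : ℝ) ^ N ≠ 0 := by positivity
    rw [← hr] at ih1
    rw [hSR, hSR', hSD, hMM.symm, hV, hU, bD0, bD1] at K
    rw [hV] at hzero
    rw [mul_log_div _ _ h2N] at ihA ihB ih0 ih1
    rw [mul_log_div _ _ two_ne_zero] at htp
    rw [mul_log_div _ _ (by positivity), pow_succ, log_mul h2N two_ne_zero]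
    rw [hV, hU, bD0, bD1] at hMM
    set r := (block 0 0 R * block 0 0 R).trace.re
    have hlr : 2 * r * log (2 * r) = 2 * r * log 2 + 2 * (r * log r) := by
      rcases eq_or_ne r 0 with h | h
      · rw [h]; simp
      · rw [log_mul two_ne_zero h]; ring
    rw [hlr] at K
    -- The normalising logarithms: each block contributes `log (2 ^ N)` times its mass. A further
    -- `log 2` comes from the two-point inequality for `D` and from the equal masses of the two
    -- blocks of `R`.
    have hd := congrArg (· * (log (2 ^ N) + log 2)) hMM
    beta_reduce at hd
    linarith

end Qubits

/-! ### Entropies and Dirichlet forms at the maximally mixed state -/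

namespace Qubits

open Matrix

section MaximallyMixed

variable {n : Type*} [Fintype n] [DecidableEq n]

lemma cfc_smul_one (f : ℝ → ℝ) (c : ℝ) :
    cfc f ((c : ℂ) • (1 : Matrix n n ℂ)) = ((f c : ℝ) : ℂ) • (1 : Matrix n n ℂ) := by
  have h : ∀ r : ℝ, (algebraMap ℝ (Matrix n n ℂ)) r = (r : ℂ) • (1 : Matrix n n ℂ) := fun r => by
    rw [Algebra.algebraMap_eq_smul_one]; rfl
  rw [← h, ← h]
  exact cfc_algebraMap c f

lemma maximallyMixed_eq :
    maximallyMixed n = (((Fintype.card n : ℝ)⁻¹ : ℝ) : ℂ) • (1 : Matrix n n ℂ) := by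
  rw [maximallyMixed]; push_cast; rfl

lemma gam_maximallyMixed [Nonempty n] (t : ℝ) (f : Matrix n n ℂ) :
    Gam (maximallyMixed n) t f = ((((Fintype.card n : ℝ)⁻¹ ^ t : ℝ)) : ℂ) • f := by
  have hd : (0 : ℝ) < (Fintype.card n : ℝ)⁻¹ := by
    have := Fintype.card_pos (α := n); positivity
  rw [Gam, matPow, maximallyMixed_eq, cfc_smul_one, smul_one_mul, mul_smul_one, smul_smul,
    ← Complex.ofReal_mul, ← rpow_add hd, add_halves]

lemma matLog_maximallyMixed :
    matLog (maximallyMixed n) = ((-log (Fintype.card n) : ℝ) : ℂ) • (1 : Matrix n n ℂ) := by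
  rw [matLog, maximallyMixed_eq, cfc_smul_one, log_inv]

lemma cfc_const_fun {f : Matrix n n ℂ} (hf : f.IsHermitian) (c : ℝ) :
    cfc (fun _ : ℝ => c) f = (c : ℂ) • (1 : Matrix n n ℂ) := by
  have h := cfc_const c f hf
  rw [Algebra.algebraMap_eq_smul_one] at h
  exact h

lemma smul_eq_cfc {f : Matrix n n ℂ} (hf : f.IsHermitian) (c : ℝ) :
    (c : ℂ) • f = cfc (fun x : ℝ => c * x) f := by
  rw [cfc_mul_apply, cfc_const_fun hf, hf.cfc_self, smul_one_mul]

lemma matLog_smul {f : Matrix n n ℂ} (hf : f.IsHermitian) (c : ℝ) :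
    matLog ((c : ℂ) • f) = cfc (fun x : ℝ => log (c * x)) f := by
  rw [matLog, smul_eq_cfc hf, ← hf.cfc_comp_apply]

/-- With `c = d^(-1/2)` the scale of `Γ^(1/2)`, the term from `log c` cancels the term from `log σ`;
only the logarithm of the norm retains the dimension. -/
lemma entTwo_maximallyMixed [Nonempty n] {f : Matrix n n ℂ} (hf : f.PosDef) :
    entTwo (maximallyMixed n) f = (specSum (fun x => x ^ 2 * log x) f
      - 1 / 2 * ((f * f).trace.re * log ((f * f).trace.re / Fintype.card n))) / Fintype.card n := by
  have hd : (0 : ℝ) < Fintype.card n := by exact_mod_cast Fintype.card_pos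
  set d : ℝ := (Fintype.card n : ℝ) with hdd
  set c : ℝ := d⁻¹ ^ (1 / 2 : ℝ) with hc
  have hc0 : 0 < c := by positivity
  have hcc : c ^ 2 = d⁻¹ := by
    rw [hc, ← rpow_natCast, ← rpow_mul (by positivity)]; norm_num
  have hlc : log c = -(1 / 2) * log d := by
    rw [hc, log_rpow (by positivity), log_inv]; ring
  have hY : specSum (fun x => x ^ 2) f = (f * f).trace.re := by
    rw [hf.1.trace_sq_eq_specSum, Complex.ofReal_re]
  have hY0 : 0 ≤ (f * f).trace.re := trace_mul_self_nonneg hf.1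
  have e1 : (trace (((c : ℂ) • f) ^ 2 * matLog ((c : ℂ) • f))).re
      = c ^ 2 * specSum (fun x => x ^ 2 * log x) f + c ^ 2 * log c * (f * f).trace.re := by
    rw [matLog_smul hf.1, sq, smul_eq_cfc hf.1, ← cfc_mul_apply, ← cfc_mul_apply,
      hf.1.trace_cfc, Complex.ofReal_re, ← hY, ← specSum_const_mul, ← specSum_const_mul,
      ← specSum_add]
    refine hf.1.specSum_congr fun i => ?_
    rw [log_mul hc0.ne' (hf.eigenvalues_pos i).ne']
    ring
  have e2 : (trace (((c : ℂ) • f) ^ 2 * matLog (maximallyMixed n))).re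
      = -(c ^ 2 * (f * f).trace.re * log d) := by
    rw [matLog_maximallyMixed, mul_smul_one, trace_smul, smul_pow, trace_smul, sq f, smul_eq_mul,
      smul_eq_mul, ← mul_assoc, ← Complex.ofReal_pow, ← Complex.ofReal_mul, Complex.re_ofReal_mul]
    ring
  have e3 : weightedNorm (maximallyMixed n) 2 f ^ 2 = c ^ 2 * (f * f).trace.re := by
    rw [weightedNorm, gam_maximallyMixed, ← hdd, ← hc, smul_eq_cfc hf.1, ← hf.1.cfc_comp_apply,
      hf.1.trace_cfc, Complex.ofReal_re, ← hY, ← specSum_const_mul]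
    have : specSum (fun x => |c * x| ^ (2 : ℝ)) f = specSum (fun x => c ^ 2 * x ^ 2) f := by
      refine hf.1.specSum_congr fun i => ?_
      rw [← mul_pow, ← sq_abs (c * _)]
      exact rpow_natCast _ 2
    rw [this, specSum_const_mul, hY, ← rpow_natCast, ← rpow_mul (by positivity)]
    norm_num
  rw [entTwo, gam_maximallyMixed, ← hdd, ← hc, e1, e2, e3, hcc, hlc, inv_mul_eq_div]
  field_simp
  ring

lemma matLog_gam_sub [Nonempty n] {f : Matrix n n ℂ} (hf : f.PosDef) :
    matLog (Gam (maximallyMixed n) 1 f) - matLog (maximallyMixed n) = cfc log f := by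
  have hd : (0 : ℝ) < Fintype.card n := by exact_mod_cast Fintype.card_pos
  rw [gam_maximallyMixed, rpow_one, matLog_smul hf.1, matLog_maximallyMixed, ← cfc_const_fun hf.1,
    ← cfc_sub_apply]
  refine hf.1.cfc_congr_eigenvalues fun i => ?_
  rw [log_mul (inv_pos.2 hd).ne' (hf.eigenvalues_pos i).ne', log_inv]
  ring

lemma entOne_maximallyMixed [Nonempty n] {f : Matrix n n ℂ} (hf : f.PosDef) :
    entOne (maximallyMixed n) f = specSum (fun x => x * log x) f / Fintype.card n
      - f.trace.re / Fintype.card n * log (f.trace.re / Fintype.card n) := by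
  have h : f * cfc log f = cfc (fun x => x * log x) f := by rw [cfc_mul_apply, hf.1.cfc_self]
  rw [entOne, matLog_gam_sub hf, gam_maximallyMixed, rpow_one, smul_mul_assoc, trace_smul,
    trace_smul, smul_eq_mul, smul_eq_mul, Complex.re_ofReal_mul, Complex.re_ofReal_mul,
    inv_mul_eq_div, inv_mul_eq_div, h, hf.1.trace_cfc, Complex.ofReal_re]

lemma dirichletOne_maximallyMixed [Nonempty n] (L : Module.End ℂ (Matrix n n ℂ))
    {f : Matrix n n ℂ} (hf : f.PosDef) :
    dirichletOne L (maximallyMixed n) f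
      = -(1 / 2) * ((L f * cfc log f).trace.re / Fintype.card n) := by
  rw [dirichletOne, matLog_gam_sub hf, gam_maximallyMixed, rpow_one, smul_mul_assoc, trace_smul,
    smul_eq_mul, Complex.re_ofReal_mul, inv_mul_eq_div]

lemma weightedInner_maximallyMixed [Nonempty n] (f g : Matrix n n ℂ) :
    weightedInner (maximallyMixed n) f g = (f * g).trace.re / Fintype.card n := by
  rw [weightedInner, gam_maximallyMixed, rpow_one, smul_mul_assoc, trace_smul, smul_eq_mul,
    Complex.re_ofReal_mul, inv_mul_eq_div]

lemma weightedVar_maximallyMixed [Nonempty n] (g : Matrix n n ℂ) :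
    weightedVar (maximallyMixed n) g
      = (g * g).trace.re / Fintype.card n - (g.trace.re / Fintype.card n) ^ 2 := by
  rw [weightedVar, weightedInner_maximallyMixed, gam_maximallyMixed, rpow_one, trace_smul,
    smul_eq_mul, Complex.re_ofReal_mul, inv_mul_eq_div]

lemma maximallyMixed_posDef [Nonempty n] : (maximallyMixed n).PosDef := by
  rw [maximallyMixed_eq]
  exact PosDef.one.smul (by exact_mod_cast inv_pos.2 (Nat.cast_pos.2 Fintype.card_pos))

lemma maximallyMixed_trace [Nonempty n] : (maximallyMixed n).trace = 1 := by
  rw [maximallyMixed, trace_smul, trace_one, smul_eq_mul,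
    inv_mul_cancel₀ (by exact_mod_cast Fintype.card_ne_zero)]

end MaximallyMixed

end Qubits

namespace Qubits

open Matrix

/-! ### The test functions with eigenvalues `1 ± t` -/

lemma le_of_forall_small {a γ : ℝ} (hγ : 0 < γ) (ha : 0 < a)
    (h : ∀ t : ℝ, 0 < t → t ≤ 1 / 2 → a * (1 - t) ≤ γ * (1 + t)) : a ≤ γ := by
  by_contra hlt
  push Not at hlt
  -- The hypothesis says `a - γ ≤ t (a + γ)`; this `t` makes the right side at most half of the
  -- left.
  set t := min (1 / 2) ((a - γ) / (2 * (a + γ))) with ht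
  have hs : 0 < a + γ := by positivity
  have h0 : 0 < t := lt_min (by norm_num) (div_pos (sub_pos.2 hlt) (by positivity))
  have h1 := h t h0 (min_le_left _ _)
  have h2 : t * (2 * (a + γ)) ≤ a - γ := by
    rw [← le_div_iff₀ (by positivity)]; exact min_le_right _ _
  nlinarith

/-- The right-hand side is `2 t²` to leading order; the Taylor bounds control the error by `t³`. -/
lemma le_entTwo_test {t : ℝ} (h0 : 0 < t) (h1 : t ≤ 1 / 2) :
    2 * (t ^ 2 * (1 - t)) ≤ (1 + t) ^ 2 * log (1 + t) + (1 - t) ^ 2 * log (1 - t)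
      - (1 + t ^ 2) * log (1 + t ^ 2) := by
  have e1 := mul_le_mul_of_nonneg_left (sub_sq_div_two_le_log_one_add h0.le) (sq_nonneg (1 + t))
  have e2 := mul_le_mul_of_nonneg_left (neg_sub_sub_cube_le_log_one_sub h0.le h1)
    (sq_nonneg (1 - t))
  have e3 : log (1 + t ^ 2) ≤ t ^ 2 := by
    have := log_le_sub_one_of_pos (x := 1 + t ^ 2) (by positivity); linarith
  have e4 : (1 + t ^ 2) * log (1 + t ^ 2) ≤ (1 + t ^ 2) * t ^ 2 :=
    mul_le_mul_of_nonneg_left e3 (by positivity)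
  have e5 : 0 ≤ t ^ 3 * (1 - t ^ 2) := mul_nonneg (by positivity) (by nlinarith)
  nlinarith

lemma diagonal_posDef {n : Type*} [Fintype n] [DecidableEq n] {g : n → ℝ} (h : ∀ i, 0 < g i) :
    (diagonal fun i => (g i : ℂ)).PosDef :=
  PosDef.diagonal fun i => by exact_mod_cast h i

lemma trace_diagonal_ofReal {n : Type*} [Fintype n] [DecidableEq n] (g : n → ℝ) :
    (diagonal fun i => (g i : ℂ)).trace.re = ∑ i, g i := by
  rw [trace_diagonal, ← Complex.ofReal_sum, Complex.ofReal_re]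

lemma diagonal_ofReal_mul {n : Type*} [Fintype n] [DecidableEq n] (g h : n → ℝ) :
    (diagonal fun i => (g i : ℂ)) * (diagonal fun i => (h i : ℂ))
      = diagonal fun i => ((g i * h i : ℝ) : ℂ) := by
  rw [diagonal_mul_diagonal]
  push_cast
  rfl

/-! ### One qubit -/

section OneQubit

variable (γ : ℝ)

lemma qubitDepol_apply (f : Matrix (Fin 2) (Fin 2) ℂ) :
    qubitDepol γ f = (γ : ℂ) • ((f.trace / 2) • (1 : Matrix (Fin 2) (Fin 2) ℂ) - f) := rfl

lemma dirichletTwo_qubitDepol {f : Matrix (Fin 2) (Fin 2) ℂ} (hf : f.IsHermitian) :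
    dirichletTwo (qubitDepol γ) (maximallyMixed (Fin 2)) f
      = γ / 2 * ((f * f).trace.re - f.trace.re ^ 2 / 2) := by
  have him : f.trace.im = 0 := by
    rw [hf.trace_eq_specSum, Complex.ofReal_im]
  rw [dirichletTwo, weightedInner_maximallyMixed, qubitDepol_apply, Matrix.mul_smul, trace_smul,
    Matrix.mul_sub, trace_sub, mul_smul_one, trace_smul, smul_eq_mul, smul_eq_mul,
    Complex.re_ofReal_mul, Complex.sub_re, Complex.mul_re, him, mul_zero, sub_zero,
    Complex.div_ofNat_re, Fintype.card_fin]
  push_cast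
  ring

lemma specSum_fin_two {f : Matrix (Fin 2) (Fin 2) ℂ} (hf : f.IsHermitian) (g : ℝ → ℝ) :
    specSum g f = g (hf.eigenvalues 0) + g (hf.eigenvalues 1) := by
  rw [hf.specSum_eq, Fin.sum_univ_two]

lemma trace_sq_fin_two {f : Matrix (Fin 2) (Fin 2) ℂ} (hf : f.IsHermitian) :
    (f * f).trace.re = hf.eigenvalues 0 ^ 2 + hf.eigenvalues 1 ^ 2 := by
  rw [hf.trace_sq_eq_specSum, Complex.ofReal_re, specSum_fin_two hf]

lemma trace_fin_two_eigenvalues {f : Matrix (Fin 2) (Fin 2) ℂ} (hf : f.IsHermitian) :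
    f.trace.re = hf.eigenvalues 0 + hf.eigenvalues 1 := by
  rw [hf.trace_eq_specSum, Complex.ofReal_re, specSum_fin_two hf]

theorem isLogSobolevConstTwo_qubitDepol (hγ : 0 < γ) :
    IsLogSobolevConstTwo (qubitDepol γ) (maximallyMixed (Fin 2)) γ := by
  refine ⟨⟨hγ, fun f hf => ?_⟩, fun a ⟨ha, h⟩ => ?_⟩
  · rw [entTwo_maximallyMixed hf, dirichletTwo_qubitDepol γ hf.1, specSum_fin_two hf.1,
      trace_sq_fin_two hf.1, trace_fin_two_eigenvalues hf.1, Fintype.card_fin, mul_comm_div]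
    have := two_point_logSobolev' (hf.eigenvalues_pos 0).le (hf.eigenvalues_pos 1).le
    rw [log_pow, log_pow] at this
    push_cast at this ⊢
    rw [mul_comm_div] at *
    have := mul_le_mul_of_nonneg_left this (by positivity : 0 ≤ γ / 4)
    nlinarith
  · refine le_of_forall_small hγ ha fun t h0 h1 => ?_
    have hpos : ∀ i : Fin 2, 0 < (![1 + t, 1 - t] : Fin 2 → ℝ) i := by
      intro i; fin_cases i
      · change 0 < 1 + t; linarith
      · change 0 < 1 - t; linarith
    have hf := diagonal_posDef hpos
    have := h _ hf
    rw [entTwo_maximallyMixed hf, dirichletTwo_qubitDepol γ hf.1, specSum_diagonal,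
      diagonal_ofReal_mul, trace_diagonal_ofReal, trace_diagonal_ofReal] at this
    simp only [Fin.sum_univ_two, cons_val_zero, cons_val_one, Fintype.card_fin] at this
    push_cast at this
    have e : ((1 + t) * (1 + t) + (1 - t) * (1 - t)) / 2 = 1 + t ^ 2 := by ring
    have e' : (1 + t) * (1 + t) + (1 - t) * (1 - t) = 2 * (1 + t ^ 2) := by ring
    rw [e, e'] at this
    have hl := mul_le_mul_of_nonneg_left (le_entTwo_test h0 h1) ha.le
    have ht2 : 0 < t ^ 2 := by positivity
    have : t ^ 2 * (a * (1 - t)) ≤ t ^ 2 * γ := by nlinarith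
    have := le_of_mul_le_mul_left this ht2
    nlinarith

lemma dirichletOne_qubitDepol {f : Matrix (Fin 2) (Fin 2) ℂ} (hf : f.PosDef) :
    dirichletOne (qubitDepol γ) (maximallyMixed (Fin 2)) f
      = γ / 4 * (specSum (fun x => x * log x) f - f.trace.re / 2 * specSum log f) := by
  have h : f * cfc log f = cfc (fun x => x * log x) f := by rw [cfc_mul_apply, hf.1.cfc_self]
  rw [dirichletOne_maximallyMixed _ hf, qubitDepol_apply, smul_mul_assoc, trace_smul,
    Matrix.sub_mul, trace_sub, smul_one_mul, trace_smul, smul_eq_mul, smul_eq_mul, h,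
    hf.1.trace_cfc, hf.1.trace_cfc, Complex.re_ofReal_mul, Complex.sub_re, Complex.ofReal_re,
    Complex.re_mul_ofReal, Complex.div_ofNat_re, Fintype.card_fin]
  push_cast
  ring

/-- The one-qubit `L_1` inequality for the eigenvalues `x`, `y`, rearranged. By homogeneity, `x, y =
m (1 ± t)` reduces it to `two_add_mul_log_le`. -/
lemma entropy_two_point_le {x y : ℝ} (hx : 0 < x) (hy : 0 < y) :
    x * log x + y * log y + (x + y) / 2 * (log x + log y)
      ≤ 4 * ((x + y) / 2 * log ((x + y) / 2)) := by
  wlog hxy : y ≤ x generalizing x y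
  · have := this hy hx (le_of_not_ge hxy)
    rw [add_comm y x] at this
    linarith
  obtain ⟨m, hm⟩ : ∃ m, m = (x + y) / 2 := ⟨_, rfl⟩
  obtain ⟨t, ht⟩ : ∃ t, t = (x - y) / (x + y) := ⟨_, rfl⟩
  have hm0 : 0 < m := by rw [hm]; positivity
  have ht0 : 0 ≤ t := by rw [ht]; exact div_nonneg (sub_nonneg.2 hxy) (by positivity)
  have ht1 : t < 1 := by rw [ht, div_lt_one (by positivity)]; linarith
  have ex : x = m * (1 + t) := by rw [hm, ht]; field_simp; ring
  have ey : y = m * (1 - t) := by rw [hm, ht]; field_simp; ring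
  rw [← hm, ex, ey, log_mul hm0.ne' (by linarith), log_mul hm0.ne' (by linarith)]
  have := mul_nonneg_of_nonpos_of_nonpos (neg_nonpos.2 hm0.le) (two_add_mul_log_le ht0 ht1)
  nlinarith

theorem isLogSobolevConstOne_qubitDepol (hγ : 0 < γ) :
    IsLogSobolevConstOne (qubitDepol γ) (maximallyMixed (Fin 2)) γ := by
  refine ⟨⟨hγ, fun f hf => ?_⟩, fun a ⟨ha, h⟩ => ?_⟩
  · rw [entOne_maximallyMixed hf, dirichletOne_qubitDepol γ hf, specSum_fin_two hf.1,
      specSum_fin_two hf.1, trace_fin_two_eigenvalues hf.1, Fintype.card_fin]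
    push_cast
    have := mul_le_mul_of_nonneg_left
      (entropy_two_point_le (hf.eigenvalues_pos 0) (hf.eigenvalues_pos 1))
      (by positivity : 0 ≤ γ / 4)
    linarith
  · refine le_of_forall_small hγ ha fun t h0 h1 => ?_
    have hpos : ∀ i : Fin 2, 0 < (![1 + t, 1 - t] : Fin 2 → ℝ) i := by
      intro i; fin_cases i
      · change 0 < 1 + t; linarith
      · change 0 < 1 - t; linarith
    have hf := diagonal_posDef hpos
    have := h _ hf
    rw [entOne_maximallyMixed hf, dirichletOne_qubitDepol γ hf, specSum_diagonal,
      specSum_diagonal, trace_diagonal_ofReal] at this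
    simp only [Fin.sum_univ_two, cons_val_zero, cons_val_one, Fintype.card_fin] at this
    push_cast at this
    rw [show (1 + t + (1 - t)) / 2 = 1 by ring, log_one] at this
    have l1 := sub_sq_div_two_le_log_one_add h0.le
    have l2 := neg_sub_sub_cube_le_log_one_sub h0.le h1
    have l3 : log (1 + t) ≤ t := by
      have := log_le_sub_one_of_pos (x := 1 + t) (by positivity); linarith
    -- At `f = diag (1 + t, 1 - t)` the mean is `1`, so twice the entropy is the right side here,
    -- and the Dirichlet form is `γ / 4` times the left side of `k2`; both are of order `t²`.
    have k1 : t ^ 2 * (1 - t) ≤ (1 + t) * log (1 + t) + (1 - t) * log (1 - t) := by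
      have e1 := mul_le_mul_of_nonneg_left l1 (by linarith : 0 ≤ 1 + t)
      have e2 := mul_le_mul_of_nonneg_left l2 (by linarith : 0 ≤ 1 - t)
      nlinarith [pow_pos h0 4]
    have k2 : t * (log (1 + t) - log (1 - t)) ≤ 2 * (t ^ 2 * (1 + t)) := by
      have : log (1 + t) - log (1 - t) ≤ 2 * (t * (1 + t)) := by nlinarith [pow_pos h0 2]
      calc t * (log (1 + t) - log (1 - t)) ≤ t * (2 * (t * (1 + t))) :=
            mul_le_mul_of_nonneg_left this h0.le
        _ = _ := by ring
    have ht2 : 0 < t ^ 2 := by positivity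
    have := mul_le_mul_of_nonneg_left k1 ha.le
    have := mul_le_mul_of_nonneg_left k2 hγ.le
    refine le_of_mul_le_mul_left ?_ ht2
    linarith

/-- One-qubit depolarization contracts everything orthogonal to the identity at the same rate, so
all quotients equal `γ`. -/
theorem isSpectralGap_qubitDepol :
    IsSpectralGap (qubitDepol γ) (maximallyMixed (Fin 2)) γ := by
  have key : ∀ g : Matrix (Fin 2) (Fin 2) ℂ, g.IsHermitian →
      dirichletTwo (qubitDepol γ) (maximallyMixed (Fin 2)) g
        = γ * weightedVar (maximallyMixed (Fin 2)) g := fun g hg => by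
    rw [dirichletTwo_qubitDepol γ hg, weightedVar_maximallyMixed, Fintype.card_fin]
    push_cast
    ring
  constructor
  · have hg : (diagonal fun i => ((![1, -1] : Fin 2 → ℝ) i : ℂ)).IsHermitian := by
      rw [IsHermitian, diagonal_conjTranspose]
      congr 1
      funext i
      simp
    have hv : weightedVar (maximallyMixed (Fin 2))
        (diagonal fun i => ((![1, -1] : Fin 2 → ℝ) i : ℂ)) = 1 := by
      rw [weightedVar_maximallyMixed, diagonal_ofReal_mul, trace_diagonal_ofReal,
        trace_diagonal_ofReal, Fin.sum_univ_two, Fin.sum_univ_two, Fintype.card_fin]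
      norm_num
    exact ⟨_, hg, by rw [hv]; exact one_ne_zero, by rw [key _ hg, hv, mul_one, div_one]⟩
  · rintro r ⟨g, hg, hv, rfl⟩
    rw [key g hg, mul_div_cancel_right₀ _ hv]

theorem isUniqueStationary_qubitDepol (hγ : 0 < γ) :
    IsUniqueFullRankStationaryState (qubitDepol γ) (maximallyMixed (Fin 2)) := by
  refine ⟨maximallyMixed_posDef, maximallyMixed_trace, fun ρ _ htr => ⟨fun h => ?_, ?_⟩⟩
  · have hγ' : (γ : ℂ) ≠ 0 := by exact_mod_cast hγ.ne'
    have h2 : ∀ f : Matrix (Fin 2) (Fin 2) ℂ, (ρ * f).trace = f.trace / 2 := fun f => by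
      have := h f
      rw [qubitDepol_apply, Matrix.mul_smul, trace_smul, Matrix.mul_sub, trace_sub, mul_smul_one,
        trace_smul, htr, smul_eq_mul, smul_eq_mul, mul_one, mul_eq_zero, or_iff_right hγ'] at this
      exact (sub_eq_zero.1 this).symm
    refine ext_iff_trace_mul_right.2 fun f => ?_
    rw [h2, maximallyMixed_eq, smul_one_mul, trace_smul, smul_eq_mul, Fintype.card_fin]
    push_cast
    ring
  · rintro rfl f
    rw [maximallyMixed_eq, smul_one_mul, trace_smul, qubitDepol_apply, trace_smul, trace_sub,
      trace_smul, trace_one]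
    simp

end OneQubit

end Qubits

/-! ### Tensor sums -/

namespace Qubits

open Matrix

variable {N : ℕ} (γ : ℝ)

lemma card_bits : (Fintype.card (Fin N → Fin 2) : ℝ) = 2 ^ N := by simp

lemma atSite_qubitDepol (k : Fin N) (f : Matrix (Fin N → Fin 2) (Fin N → Fin 2) ℂ) :
    atSite (qubitDepol γ) k f = (γ : ℂ) • (siteExp k f - f) := by
  ext x y
  change (qubitDepol γ (of fun a b => f (Function.update x k a) (Function.update y k b)))
    (x k) (y k) = (γ : ℂ) • ((depolarize
      (of fun a b => f (Function.update x k a) (Function.update y k b))) (x k) (y k) - f x y)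
  rw [qubitDepol_apply, Matrix.smul_apply, Matrix.sub_apply, of_apply, Function.update_eq_self,
    Function.update_eq_self]
  rfl

lemma tensorSum_qubitDepol (f : Matrix (Fin N → Fin 2) (Fin N → Fin 2) ℂ) :
    tensorSum N (qubitDepol γ) f = (γ : ℂ) • ∑ k, (siteExp k f - f) := by
  rw [tensorSum, LinearMap.sum_apply, Finset.smul_sum]
  exact Finset.sum_congr rfl fun k _ => atSite_qubitDepol γ k f

lemma trace_mul_tensorSum (ρ f : Matrix (Fin N → Fin 2) (Fin N → Fin 2) ℂ) :
    (ρ * tensorSum N (qubitDepol γ) f).trace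
      = (γ : ℂ) * ∑ k, ((ρ * siteExp k f).trace - (ρ * f).trace) := by
  rw [tensorSum_qubitDepol, Matrix.mul_smul, trace_smul, Matrix.mul_sum, trace_sum, smul_eq_mul]
  simp only [Matrix.mul_sub, trace_sub]

lemma dirichletTwo_tensorSum (f : Matrix (Fin N → Fin 2) (Fin N → Fin 2) ℂ) :
    dirichletTwo (tensorSum N (qubitDepol γ)) (maximallyMixed (Fin N → Fin 2)) f
      = γ * (∑ k, siteForm k f) / 2 ^ N := by
  rw [dirichletTwo, weightedInner_maximallyMixed, trace_mul_tensorSum, Complex.re_ofReal_mul,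
    Complex.re_sum, card_bits, ← neg_div, ← mul_neg, ← Finset.sum_neg_distrib]
  simp only [Complex.sub_re, neg_sub]
  rfl

/-! ### The Dirichlet form of a site as a sum of squares -/

/-- Flipping the bit at site `k`. -/
def flipBit (k : Fin N) : Equiv.Perm (Fin N → Fin 2) :=
  Function.Involutive.toPerm (fun x => Function.update x k (x k + 1)) fun x => by
    have h : ∀ a : Fin 2, a + 1 + 1 = a := by decide
    simp [h]

lemma sum_update_eq {M : Type*} [AddCommMonoid M] (k : Fin N) (x y : Fin N → Fin 2)
    (h : x k = y k) (X : (Fin N → Fin 2) → (Fin N → Fin 2) → M) :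
    ∑ a, X (Function.update x k a) (Function.update y k a)
      = X x y + X (flipBit k x) (flipBit k y) := by
  have e : ∀ z : Fin N → Fin 2, flipBit k z = Function.update z k (z k + 1) := fun _ => rfl
  have s : ∀ z : Fin N → Fin 2, z = Function.update z k (z k) := fun z => by simp
  rw [e, e, Fin.sum_univ_two]
  conv_rhs => enter [1]; rw [s x, s y]
  rw [← h]
  generalize x k = u
  fin_cases u
  · simp
  · simp [add_comm]

lemma flipBit_apply_self (k : Fin N) (x : Fin N → Fin 2) : flipBit k x k = x k + 1 :=
  Function.update_self ..

lemma siteExp_apply_flip (k : Fin N) (X : Matrix (Fin N → Fin 2) (Fin N → Fin 2) ℂ)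
    (x y : Fin N → Fin 2) :
    siteExp k X x y = if x k = y k then (X x y + X (flipBit k x) (flipBit k y)) / 2 else 0 := by
  rw [siteExp_apply]
  split_ifs with h
  · exact congrArg (· / 2) (sum_update_eq k x y h fun a b => X a b)
  · rfl

lemma trace_siteExp (k : Fin N) (X : Matrix (Fin N → Fin 2) (Fin N → Fin 2) ℂ) :
    (siteExp k X).trace = X.trace := by
  simp only [trace, diag_apply, siteExp_apply_flip, if_true, ← Finset.sum_div,
    Finset.sum_add_distrib]
  rw [Equiv.sum_comp (flipBit k) fun x => X x x]
  ring

/-- `E_k` deletes the entries off-diagonal at `k` and averages each other entry with its flip. Entry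
by entry the two sides differ by a quarter of `|X x y|²` minus its flipped value, which sums to
zero. -/
lemma siteForm_eq_sum_sq (k : Fin N) {X : Matrix (Fin N → Fin 2) (Fin N → Fin 2) ℂ}
    (hX : X.IsHermitian) :
    siteForm k X = ∑ x, ∑ y, if x k = y k
      then Complex.normSq (X x y - X (flipBit k x) (flipBit k y)) / 4
      else Complex.normSq (X x y) := by
  have h1 : (X * siteExp k X).trace.re = ∑ x, ∑ y, if x k = y k
      then (Complex.normSq (X x y)
        + (X x y * starRingEnd ℂ (X (flipBit k x) (flipBit k y))).re) / 2 else 0 := by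
    simp only [trace, diag_apply, mul_apply, Complex.re_sum]
    refine Finset.sum_congr rfl fun x _ => Finset.sum_congr rfl fun y _ => ?_
    rw [siteExp_apply_flip]
    by_cases h : x k = y k
    · rw [if_pos h, if_pos h.symm, ← hX.apply y x, ← hX.apply (flipBit k y), mul_div_assoc',
        Complex.div_ofNat_re, mul_add, Complex.add_re, Complex.star_def,
        Complex.mul_conj, Complex.ofReal_re]
    · rw [if_neg h, if_neg (Ne.symm h), mul_zero, Complex.zero_re]
  -- the flip preserves the total weight of the entries diagonal at `k`
  have h2 : ∑ x, ∑ y, (if x k = y k then Complex.normSq (X (flipBit k x) (flipBit k y)) else 0)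
      = ∑ x, ∑ y, if x k = y k then Complex.normSq (X x y) else 0 := by
    rw [← Equiv.sum_comp (flipBit k) fun x => ∑ y, if x k = y k then Complex.normSq (X x y) else 0]
    refine Finset.sum_congr rfl fun x _ => ?_
    rw [← Equiv.sum_comp (flipBit k) fun y => if flipBit k x k = y k then
      Complex.normSq (X (flipBit k x) y) else 0]
    simp only [flipBit_apply_self, add_left_inj]
  rw [siteForm, h1, trace_sq_eq_sum_normSq hX, ← sub_eq_zero]
  have h3 : ∀ x y : Fin N → Fin 2, Complex.normSq (X x y)
      - (if x k = y k then (Complex.normSq (X x y)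
        + (X x y * starRingEnd ℂ (X (flipBit k x) (flipBit k y))).re) / 2 else 0)
      - (if x k = y k then Complex.normSq (X x y - X (flipBit k x) (flipBit k y)) / 4
        else Complex.normSq (X x y))
      = 1 / 4 * ((if x k = y k then Complex.normSq (X x y) else 0)
        - if x k = y k then Complex.normSq (X (flipBit k x) (flipBit k y)) else 0) := by
    intro x y
    split_ifs
    · rw [Complex.normSq_sub]; ring
    · ring
  simp only [← Finset.sum_sub_distrib, h3]
  simp only [← Finset.mul_sum, Finset.sum_sub_distrib, h2, sub_self, mul_zero]

/-- Any bit string is reached from any other by changing one bit at a time. -/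
lemma eq_of_flipBit_invariant {M : Type*} (g : (Fin N → Fin 2) → M)
    (h : ∀ k x, g (flipBit k x) = g x) (x y : Fin N → Fin 2) : g x = g y := by
  have hu : ∀ k a x, g (Function.update x k a) = g x := by
    intro k a x
    by_cases ha : a = x k
    · rw [ha, Function.update_eq_self]
    · have : a = x k + 1 := by
        revert ha; generalize x k = b; revert a b; decide
      rw [this]; exact h k x
  have hs : ∀ s : Finset (Fin N), g (s.piecewise x y) = g y := by
    intro s
    induction s using Finset.induction_on with
    | empty => rw [Finset.piecewise_empty]
    | insert k s _ ih => rw [Finset.piecewise_insert, hu, ih]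
  have := hs Finset.univ
  rwa [Finset.piecewise_univ] at this

/-- Testing stationarity on `f = ρ` itself gives a vanishing sum of the nonnegative site forms. Each
of their squares vanishes: entries off the diagonal are zero, and the diagonal is invariant under
every bit flip. -/
theorem isUniqueStationary_tensorSum (hγ : 0 < γ) :
    IsUniqueFullRankStationaryState (tensorSum N (qubitDepol γ))
      (maximallyMixed (Fin N → Fin 2)) := by
  refine ⟨maximallyMixed_posDef, maximallyMixed_trace, fun ρ hρ htr => ⟨fun h => ?_, ?_⟩⟩
  · have h1 := h ρ
    have hγ' : (γ : ℂ) ≠ 0 := by exact_mod_cast hγ.ne'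
    rw [trace_mul_tensorSum, mul_eq_zero, or_iff_right hγ'] at h1
    have hterm : ∀ k x y, 0 ≤ (if x k = y k
        then Complex.normSq (ρ x y - ρ (flipBit k x) (flipBit k y)) / 4
        else Complex.normSq (ρ x y) : ℝ) := fun k x y => by
      split_ifs
      · exact div_nonneg (Complex.normSq_nonneg _) (by norm_num)
      · exact Complex.normSq_nonneg _
    have hnn : ∀ k ∈ Finset.univ, 0 ≤ siteForm k ρ := fun k _ => by
      rw [siteForm_eq_sum_sq k hρ.1]
      exact Finset.sum_nonneg fun x _ => Finset.sum_nonneg fun y _ => hterm k x y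
    have h2 : ∑ k, siteForm k ρ = 0 := by
      have := congrArg Complex.re h1
      rw [Complex.re_sum, Complex.zero_re] at this
      rw [← neg_eq_zero, ← Finset.sum_neg_distrib, ← this]
      refine Finset.sum_congr rfl fun k _ => ?_
      rw [siteForm, Complex.sub_re]; ring
    have h3 : ∀ k x y, (if x k = y k
        then Complex.normSq (ρ x y - ρ (flipBit k x) (flipBit k y)) / 4
        else Complex.normSq (ρ x y) : ℝ) = 0 := fun k x y => by
      have h4 := (Finset.sum_eq_zero_iff_of_nonneg hnn).1 h2 k (Finset.mem_univ k)
      rw [siteForm_eq_sum_sq k hρ.1] at h4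
      have h5 := (Finset.sum_eq_zero_iff_of_nonneg fun x _ =>
        Finset.sum_nonneg fun y _ => hterm k x y).1 h4 x (Finset.mem_univ x)
      exact (Finset.sum_eq_zero_iff_of_nonneg fun y _ => hterm k x y).1 h5 y (Finset.mem_univ y)
    have hoff : ∀ x y, x ≠ y → ρ x y = 0 := fun x y hxy => by
      obtain ⟨k, hk⟩ := Function.ne_iff.1 hxy
      have := h3 k x y
      rw [if_neg hk] at this
      exact Complex.normSq_eq_zero.1 this
    have hdiag : ∀ x y, ρ x x = ρ y y := eq_of_flipBit_invariant (fun x => ρ x x) fun k x => by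
      have := h3 k x x
      rw [if_pos rfl, div_eq_zero_iff, or_iff_left (by norm_num)] at this
      exact (sub_eq_zero.1 (Complex.normSq_eq_zero.1 this)).symm
    ext x y
    rw [maximallyMixed, Matrix.smul_apply, one_apply, smul_eq_mul, mul_ite, mul_one, mul_zero]
    split_ifs with hxy
    · subst hxy
      have : ρ.trace = Fintype.card (Fin N → Fin 2) * ρ x x := by
        rw [trace, Finset.sum_congr rfl fun y _ => (diag_apply ρ y).trans (hdiag y x)]
        simp
      rw [htr] at this
      exact eq_inv_of_mul_eq_one_right this.symm
    · exact hoff x y hxy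
  · rintro rfl f
    rw [trace_mul_tensorSum]
    simp [maximallyMixed, trace_siteExp]

lemma siteForm_smul_one (k : Fin N) (c : ℂ) :
    siteForm k (c • (1 : Matrix (Fin N → Fin 2) (Fin N → Fin 2) ℂ)) = 0 := by
  have h : siteExp k (1 : Matrix (Fin N → Fin 2) (Fin N → Fin 2) ℂ) = 1 := by
    ext x y
    simp only [siteExp_apply_flip, one_apply, (flipBit k).injective.eq_iff]
    by_cases hxy : x = y
    · simp [hxy]
    · simp [hxy]
  rw [siteForm, map_smul, h, sub_self]

/-- A function of the first bit alone is scalar on each block, so only the first site contributes;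
optimality for `N` qubits is thereby reduced to one qubit. -/
lemma siteForm_diagonal_first (g : Fin 2 → ℝ) :
    ∑ k, siteForm k (diagonal fun x : Fin (N + 1) → Fin 2 => (g (x 0) : ℂ))
      = 2 ^ N * (g 0 - g 1) ^ 2 / 2 := by
  have hb : ∀ a b, block a b (diagonal fun x : Fin (N + 1) → Fin 2 => (g (x 0) : ℂ))
      = if a = b then (g a : ℂ) • (1 : Matrix (Fin N → Fin 2) (Fin N → Fin 2) ℂ) else 0 := by
    intro a b
    ext x y
    simp only [block, submatrix_apply, diagonal_apply, Fin.cons_inj, Fin.cons_zero]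
    by_cases hab : a = b
    · simp [hab, one_apply]
    · simp [hab]
  have h0 := siteForm_zero (diagonal fun x : Fin (N + 1) → Fin 2 => (g (x 0) : ℂ))
  simp only [hb, if_true, zero_ne_one, one_ne_zero, if_false, mul_zero, trace_zero, add_zero,
    Complex.zero_re, ← sub_smul, smul_mul_smul_comm, mul_one, trace_smul, trace_one] at h0
  rw [← Complex.ofReal_sub, ← Complex.ofReal_mul, smul_eq_mul, Complex.re_ofReal_mul,
    Complex.natCast_re, card_bits] at h0
  rw [Fin.sum_univ_succ, Finset.sum_eq_zero, add_zero]
  · linarith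
  · intro k _
    rw [siteForm_succ_block_diag k (by simp [hb]), hb, hb, if_pos rfl, if_pos rfl,
      siteForm_smul_one, siteForm_smul_one, add_zero]

theorem isLogSobolevConstTwo_tensorSum (hγ : 0 < γ) (hN : 1 ≤ N) :
    IsLogSobolevConstTwo (tensorSum N (qubitDepol γ)) (maximallyMixed (Fin N → Fin 2)) γ := by
  refine ⟨⟨hγ, fun f hf => ?_⟩, fun a ⟨ha, h⟩ => ?_⟩
  · rw [entTwo_maximallyMixed hf, dirichletTwo_tensorSum, card_bits, mul_div_assoc']
    have := logSobolev N f hf.posSemidef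
    refine div_le_div_of_nonneg_right (mul_le_mul_of_nonneg_left ?_ hγ.le) (by positivity)
    linarith
  -- The test function takes the values `1 ± t` according to the first bit, so a first qubit must
  -- exist.
  · obtain ⟨M, rfl⟩ : ∃ M, N = M + 1 := ⟨N - 1, by omega⟩
    refine le_of_forall_small hγ ha fun t h0 h1 => ?_
    have hpos : ∀ i : Fin 2, 0 < (![1 + t, 1 - t] : Fin 2 → ℝ) i := by
      intro i; fin_cases i
      · change 0 < 1 + t; linarith
      · change 0 < 1 - t; linarith
    have hf := diagonal_posDef (fun x : Fin (M + 1) → Fin 2 => hpos (x 0))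
    have := h _ hf
    rw [entTwo_maximallyMixed hf, dirichletTwo_tensorSum, specSum_diagonal,
      diagonal_ofReal_mul, trace_diagonal_ofReal, siteForm_diagonal_first, card_bits] at this
    simp only [sum_splitFirst, Fin.cons_zero, Finset.sum_const, Finset.card_univ, cons_val_zero,
      cons_val_one, nsmul_eq_mul, card_bits] at this
    have e : (2 ^ M * ((1 + t) * (1 + t)) + 2 ^ M * ((1 - t) * (1 - t))) / 2 ^ (M + 1)
        = 1 + t ^ 2 := by
      rw [pow_succ]; field_simp; ring
    have e' : 2 ^ M * ((1 + t) * (1 + t)) + 2 ^ M * ((1 - t) * (1 - t))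
        = 2 ^ M * (2 * (1 + t ^ 2)) := by ring
    have e1 : a * ((2 ^ M * ((1 + t) ^ 2 * log (1 + t)) + 2 ^ M * ((1 - t) ^ 2 * log (1 - t))
        - 1 / 2 * (2 ^ M * (2 * (1 + t ^ 2)) * log (1 + t ^ 2))) / 2 ^ (M + 1))
        = a / 2 * ((1 + t) ^ 2 * log (1 + t) + (1 - t) ^ 2 * log (1 - t)
          - (1 + t ^ 2) * log (1 + t ^ 2)) := by
      rw [pow_succ]; field_simp; ring
    have e2 : γ * (2 ^ M * (1 + t - (1 - t)) ^ 2 / 2) / 2 ^ (M + 1) = γ * t ^ 2 := by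
      rw [pow_succ]; field_simp; ring
    rw [e, e', e1, e2] at this
    have hl := mul_le_mul_of_nonneg_left (le_entTwo_test h0 h1) (by positivity : 0 ≤ a / 2)
    have ht2 : 0 < t ^ 2 := by positivity
    have : t ^ 2 * (a * (1 - t)) ≤ t ^ 2 * γ := by linarith
    have := le_of_mul_le_mul_left this ht2
    nlinarith

end Qubits

open Qubits in
theorem lemma5p2 (γ : ℝ) (hγ : 0 < γ) :
    IsUniqueFullRankStationaryState (qubitDepol γ) (maximallyMixed (Fin 2)) ∧
    IsLogSobolevConstTwo (qubitDepol γ) (maximallyMixed (Fin 2)) γ ∧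
    IsLogSobolevConstOne (qubitDepol γ) (maximallyMixed (Fin 2)) γ ∧
    IsSpectralGap (qubitDepol γ) (maximallyMixed (Fin 2)) γ ∧
    ∀ N : ℕ, 1 ≤ N →
      IsUniqueFullRankStationaryState (tensorSum N (qubitDepol γ))
        (maximallyMixed (Fin N → Fin 2)) ∧
      IsLogSobolevConstTwo (tensorSum N (qubitDepol γ)) (maximallyMixed (Fin N → Fin 2)) γ :=
  ⟨isUniqueStationary_qubitDepol γ hγ, isLogSobolevConstTwo_qubitDepol γ hγ,
    isLogSobolevConstOne_qubitDepol γ hγ, isSpectralGap_qubitDepol γ, fun _ hN =>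
      ⟨isUniqueStationary_tensorSum γ hγ, isLogSobolevConstTwo_tensorSum γ hγ hN⟩⟩
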